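/- Fix a vocabulary $L$ (relation, function and constant symbols) and $k\in\mathbb N$. $L$-models have nonempty universes. A team $X$ for a model $\mathcal M$ with universe $M$ is a set of assignments $s:V\to M$ with a common domain $V$ of variables. Formulas of $k$-ary inclusion-exclusion logic $\mathrm{INEX}[k]$ are built from literals $t_1=t_2$, $\neg t_1=t_2$, $R\vec t$, $\neg R\vec t$, inclusion atoms $\vec t_1\subseteq\vec t_2$ and exclusion atoms $\vec t_1\mid\vec t_2$ (where $\vec t_1,\vec t_2$ are $m$-tuples of $L$-terms with $m\le k$) by $\wedge$, $\vee$, $\exists x$, $\forall x$. Formulas of $k$-ary exclusion logic $\mathrm{EXC}[k]$ are those without inclusion atoms. For a team $X$ whose domain contains the free variables, truth $\mathcal M\models_X\varphi$ is defined by: - a literal holds in $X$ iff every $s\in X$ satisfies it in the usual sense; - $\mathcal M\models_X\vec t_1\subseteq\vec t_2$ iff for every $s\in X$ there is $s'\in X$ with $s(\vec t_1)=s'(\vec t_2)$; - $\mathcal M\models_X\vec t_1\mid\vec t_2$ iff $s(\vec t_1)\ne s'(\vec t_2)$ for all $s,s'\in X$; - $\mathcal M\models_X\psi\wedge\theta$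 iff $\mathcal M\models_X\psi$ and $\mathcal M\models_X\theta$; - $\mathcal M\models_X\psi\vee\theta$ iff there are $Y,Y'\subseteq X$ with $Y\cup Y'=X$, $\mathcal M\models_Y\psi$ and $\mathcal M\models_{Y'}\theta$; - $\mathcal M\models_X\exists x\,\psi$ iff there is $F:X\to\mathcal P(M)\setminus\{\emptyset\}$ such that $\psi$ holds in $\{s[a/x]: s\in X,\ a\in F(s)\}$; - $\mathcal M\models_X\forall x\,\psi$ iff $\psi$ holds in $\{s[a/x]: s\in X,\ a\in M\}$. A sentence $\varphi$ (a formula without free variables) is true in $\mathcal M$, written $\mathcal M\models\varphi$, iff $\mathcal M\models_{\{\emptyset\}}\varphi$, where $\emptyset$ is the empty assignment. A sentence of $k$-ary existential second-order logic $\mathrm{ESO}[k]$ over $L$ has the form $\exists P_1\dots\exists P_n\,\delta$, where $P_1,\dots,P_n$ are relation symbols of arity at most $k$ not in $L$ and $\delta$ is a first-order sentence over $L\cup\{P_1,\dots,P_n\}$. It is true in $\mathcal M$ iff there are relations $A_1,\dots,A_n$ on $M$ of the corresponding arities such that the expansion $\mathcal M[A_1/P_1,\dots,A_n/P_n]$ satisfies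 $\delta$ in the usual sense. Two logics are equivalent on the level of sentences if for each sentence of either one there is a sentence of the other, over the same vocabulary $L$, that is true in exactly the same $L$-models. **Theorem.** On the level of sentences, $\mathrm{EXC}[k]\equiv\mathrm{ESO}[k]$. Consequently, on the level of sentences, $\mathrm{INEX}[k]\equiv\mathrm{EXC}[k]$, so $k$-ary inclusion atoms do not increase the expressive power of $\mathrm{EXC}[k]$ at the sentence level. -/

import Mathlib

universe u v w

namespace TeamLogic

open FirstOrder

/-- Formulas of inclusion-exclusion logic over the vocabulary `L` (constants are the function
symbols of arity `0`) whose free variables lie in the finite set `V` of variables; variables are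
natural numbers, and a quantified variable may be requantified.  Formulas are in negation normal
form: negation occurs only in front of equations and relational atoms. -/
inductive TeamFormula (L : FirstOrder.Language.{u, v}) : Finset ℕ → Type (max u v)
  | eq {V : Finset ℕ} (t₁ t₂ : L.Term V) : TeamFormula L V
  | neq {V : Finset ℕ} (t₁ t₂ : L.Term V) : TeamFormula L V
  | rel {V : Finset ℕ} {m : ℕ} (R : L.Relations m) (t : Fin m → L.Term V) : TeamFormula L V
  | nrel {V : Finset ℕ} {m : ℕ} (R : L.Relations m) (t : Fin m → L.Term V) : TeamFormula L V
  | incl {V : Finset ℕ} {m : ℕ} (t₁ t₂ : Fin m → L.Term V) : TeamFormula L V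
  | excl {V : Finset ℕ} {m : ℕ} (t₁ t₂ : Fin m → L.Term V) : TeamFormula L V
  | and {V : Finset ℕ} (φ ψ : TeamFormula L V) : TeamFormula L V
  | or {V : Finset ℕ} (φ ψ : TeamFormula L V) : TeamFormula L V
  | ex {V : Finset ℕ} (x : ℕ) (φ : TeamFormula L (insert x V)) : TeamFormula L V
  | all {V : Finset ℕ} (x : ℕ) (φ : TeamFormula L (insert x V)) : TeamFormula L V

/-- The assignment `s[a/x]`, with domain `dom(s) ∪ {x}`. -/
def extend {M : Type w} {V : Finset ℕ} (s : V → M) (x : ℕ) (a : M) :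
    ↥(insert x V) → M :=
  fun y => if h : y.1 = x then a else s ⟨y.1, Finset.mem_of_mem_insert_of_ne y.2 h⟩

/-- The team `X[F/x] = {s[a/x] | s ∈ X, a ∈ F(s)}`. -/
def supplement {M : Type w} {V : Finset ℕ} (X : Set (V → M)) (x : ℕ) (F : X → Set M) :
    Set (↥(insert x V) → M) :=
  {s' | ∃ s : X, ∃ a ∈ F s, s' = extend s.1 x a}

/-- The tuple of values `s(t)`. -/
def tupleVal {L : FirstOrder.Language.{u, v}} {M : Type w} [L.Structure M] {V : Finset ℕ} {m : ℕ}
    (t : Fin m → L.Term V) (s : V → M) : Fin m → M :=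
  fun i => (t i).realize s

/-- (Lax) team semantics: truth of `φ` in the model `M` and the team `X` with domain `V`. -/
def TeamFormula.Holds {L : FirstOrder.Language.{u, v}} {M : Type w} [L.Structure M] :
    {V : Finset ℕ} → TeamFormula L V → Set (V → M) → Prop
  | _, .eq t₁ t₂, X => ∀ s ∈ X, t₁.realize s = t₂.realize s
  | _, .neq t₁ t₂, X => ∀ s ∈ X, t₁.realize s ≠ t₂.realize s
  | _, .rel R t, X => ∀ s ∈ X, FirstOrder.Language.Structure.RelMap R (tupleVal t s)
  | _, .nrel R t, X => ∀ s ∈ X, ¬ FirstOrder.Language.Structure.RelMap R (tupleVal t s)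
  | _, .incl t₁ t₂, X => ∀ s ∈ X, ∃ s' ∈ X, tupleVal t₁ s = tupleVal t₂ s'
  | _, .excl t₁ t₂, X => ∀ s ∈ X, ∀ s' ∈ X, tupleVal t₁ s ≠ tupleVal t₂ s'
  | _, .and φ ψ, X => φ.Holds X ∧ ψ.Holds X
  | _, .or φ ψ, X => ∃ Y Y', Y ⊆ X ∧ Y' ⊆ X ∧ Y ∪ Y' = X ∧ φ.Holds Y ∧ ψ.Holds Y'
  | _, .ex x φ, X => ∃ F : X → Set M, (∀ s, (F s).Nonempty) ∧ φ.Holds (supplement X x F)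
  | _, .all x φ, X => φ.Holds (supplement X x fun _ => Set.univ)

/-- `φ` belongs to `k`-ary inclusion-exclusion logic `INEX[k]`. -/
def TeamFormula.IsINEX {L : FirstOrder.Language.{u, v}} (k : ℕ) : {V : Finset ℕ} → TeamFormula L V → Prop
  | _, .eq _ _ => True
  | _, .neq _ _ => True
  | _, .rel _ _ => True
  | _, .nrel _ _ => True
  | _, .incl (m := m) _ _ => m ≤ k
  | _, .excl (m := m) _ _ => m ≤ k
  | _, .and φ ψ => φ.IsINEX k ∧ ψ.IsINEX k
  | _, .or φ ψ => φ.IsINEX k ∧ ψ.IsINEX k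
  | _, .ex _ φ => φ.IsINEX k
  | _, .all _ φ => φ.IsINEX k

/-- `φ` belongs to `k`-ary exclusion logic `EXC[k]`. -/
def TeamFormula.IsEXC {L : FirstOrder.Language.{u, v}} (k : ℕ) : {V : Finset ℕ} → TeamFormula L V → Prop
  | _, .eq _ _ => True
  | _, .neq _ _ => True
  | _, .rel _ _ => True
  | _, .nrel _ _ => True
  | _, .incl _ _ => False
  | _, .excl (m := m) _ _ => m ≤ k
  | _, .and φ ψ => φ.IsEXC k ∧ ψ.IsEXC k
  | _, .or φ ψ => φ.IsEXC k ∧ ψ.IsEXC k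
  | _, .ex _ φ => φ.IsEXC k
  | _, .all _ φ => φ.IsEXC k

/-- The sentences of `INEX[k]`. -/
def INEXSentence (L : FirstOrder.Language.{u, v}) (k : ℕ) : Type (max u v) :=
  {φ : TeamFormula L ∅ // φ.IsINEX k}

/-- The sentences of `EXC[k]`. -/
def EXCSentence (L : FirstOrder.Language.{u, v}) (k : ℕ) : Type (max u v) :=
  {φ : TeamFormula L ∅ // φ.IsEXC k}

/-- The assignment with empty domain. -/
def emptyAssignment (M : Type w) : ↥(∅ : Finset ℕ) → M :=
  fun x => absurd x.2 (Finset.notMem_empty x.1)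

/-- Truth of a sentence of team logic: truth in the team whose only member is the empty
assignment. -/
def TeamFormula.TrueIn {L : FirstOrder.Language.{u, v}} (φ : TeamFormula L ∅) (M : Type w)
    [L.Structure M] : Prop :=
  φ.Holds {emptyAssignment M}

/-- The vocabulary `{P₁, …, Pₙ}` of relation symbols, where `Pᵢ` has arity `ar i`. -/
def relVars {n : ℕ} (ar : Fin n → ℕ) : FirstOrder.Language.{0, 0} where
  Functions := fun _ => Empty
  Relations := fun m => {i : Fin n // ar i = m}

/-- The interpretation of `P₁, …, Pₙ` by the relations `A₁, …, Aₙ`. -/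
abbrev relVarsStructure {n : ℕ} {ar : Fin n → ℕ} {M : Type w}
    (A : (i : Fin n) → Set (Fin (ar i) → M)) : (relVars ar).Structure M where
  funMap := fun f _ => Empty.elim f
  RelMap := fun P a => (fun j => a (Fin.cast P.2 j)) ∈ A P.1

/-- The sentences `∃P₁ … ∃Pₙ δ` of `k`-ary existential second-order logic `ESO[k]`: each `Pᵢ` is
a relation symbol of arity at most `k`, and `δ` is a first-order sentence in the vocabulary
`L ∪ {P₁, …, Pₙ}`. -/
structure ESOSentence (L : FirstOrder.Language.{u, v}) (k : ℕ) where
  n : ℕ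
  ar : Fin n → ℕ
  ar_le : ∀ i, ar i ≤ k
  body : (L.sum (relVars ar)).Sentence

/-- Truth of `∃P₁ … ∃Pₙ δ` in `M`: the expansion `M[A₁/P₁, …, Aₙ/Pₙ]` satisfies `δ` (in Tarski
semantics) for some relations `A₁, …, Aₙ` on `M`. -/
def ESOSentence.TrueIn {L : FirstOrder.Language.{u, v}} {k : ℕ} (Φ : ESOSentence L k) (M : Type w)
    [L.Structure M] : Prop :=
  ∃ A : (i : Fin Φ.n) → Set (Fin (Φ.ar i) → M),
    letI : (relVars Φ.ar).Structure M := relVarsStructure A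
    M ⊨ Φ.body

end TeamLogic

namespace TeamLogic

open FirstOrder

/-! From team logic to `ESO[k]`: a team may have many variables, so it cannot itself be quantified
as a relation of arity at most `k`. Instead, induction on the formula shows that truth in `X` always
has the shape of `HasRelationalForm`. There are relations `A i` of arity at most `k` such that every
member of `X` satisfies a first-order condition, and every tuple of each `A j` is witnessed by a
member of `X`. New relations enter only at inclusion and exclusion atoms. For the team of the empty
assignment this shape is an `ESO[k]` sentence.

From `ESO[k]` to `EXC[k]`: quantify universally tuples `z i`, then existentially tuples `w i` and
`w' i`, and demand that `w i` excludes `w' i` and that `z i` equals one of them. As `z` takes all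
values, the values of `w i` form a relation `A i` and those of `w' i` its complement. The
quantifiers of the prenex body are then copied. A literal on `A i` becomes a fresh tuple `u` that
excludes `w' i` (to be in `A i`) or `w i` (to be outside).

The obstacle is disjunction: in a subteam `w i` and `w' i` may lose values, and an exclusion atom
there says too little. Hence all literal tuples are quantified before the matrix and all exclusion
atoms are pulled out of it as conjuncts (`LiteralDefinable`), so only a flat matrix splits the team.
A disjunct that is not chosen still needs tuples for its literals, which requires `A i` to be
neither empty nor full. A pattern `σ` therefore fixes which `A i` are trivial, and the final
sentence is the disjunction over the finitely many `σ`.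

The equivalence with `INEX[k]` follows by passing through `ESO[k]`, since the first translation also
handles inclusion atoms. -/

/-! ### First-order definability with relation parameters -/

/-- The relational vocabulary with one relation symbol of arity `ar i` for each `i : ι`. -/
def indexedRelVars {ι : Type} (ar : ι → ℕ) : FirstOrder.Language.{0, 0} where
  Functions := fun _ => Empty
  Relations := fun m => {i : ι // ar i = m}

/-- The interpretation of the relation symbols of `indexedRelVars ar` by the relations `A i`. -/
abbrev indexedRelVarsStructure {ι : Type} {ar : ι → ℕ} {M : Type w}
    (A : (i : ι) → Set (Fin (ar i) → M)) : (indexedRelVars ar).Structure M where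
  funMap := fun f _ => Empty.elim f
  RelMap := fun P a => (fun j => a (Fin.cast P.2 j)) ∈ A P.1

/-- A property of assignments, depending on a structure and on relations `A i` on it, is
first-order definable if a formula over `L` expanded by symbols for the `A i` defines it in every
nonempty structure. -/
def FODefinable (L : FirstOrder.Language.{u, v}) {ι : Type} (ar : ι → ℕ) {α : Type}
    (p : ∀ (M : Type w) [L.Structure M], ((i : ι) → Set (Fin (ar i) → M)) → (α → M) → Prop) :
    Prop :=
  ∃ ψ : (L.sum (indexedRelVars ar)).Formula α,
    ∀ (M : Type w) [Nonempty M] [L.Structure M] (A : (i : ι) → Set (Fin (ar i) → M)) (s : α → M),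
      (letI := indexedRelVarsStructure A; ψ.Realize s) ↔ p M A s

namespace FODefinable

variable {L : FirstOrder.Language.{u, v}} {ι ι' : Type} {ar : ι → ℕ} {α β : Type}
  {p q : ∀ (M : Type w) [L.Structure M], ((i : ι) → Set (Fin (ar i) → M)) → (α → M) → Prop}

theorem and (hp : FODefinable L ar p) (hq : FODefinable L ar q) :
    FODefinable L ar (fun M _ A s => p M A s ∧ q M A s) := by
  obtain ⟨ψ, hψ⟩ := hp
  obtain ⟨θ, hθ⟩ := hq
  refine ⟨ψ ⊓ θ, fun M _ _ A s => ?_⟩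
  let := indexedRelVarsStructure A
  beta_reduce
  rw [← hψ, ← hθ]
  exact Language.Formula.realize_inf

theorem or (hp : FODefinable L ar p) (hq : FODefinable L ar q) :
    FODefinable L ar (fun M _ A s => p M A s ∨ q M A s) := by
  obtain ⟨ψ, hψ⟩ := hp
  obtain ⟨θ, hθ⟩ := hq
  refine ⟨ψ ⊔ θ, fun M _ _ A s => ?_⟩
  let := indexedRelVarsStructure A
  beta_reduce
  rw [← hψ, ← hθ]
  exact Language.Formula.realize_sup

theorem not (hp : FODefinable L ar p) : FODefinable L ar (fun M _ A s => ¬ p M A s) := by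
  obtain ⟨ψ, hψ⟩ := hp
  refine ⟨ψ.not, fun M _ _ A s => ?_⟩
  let := indexedRelVarsStructure A
  beta_reduce
  rw [← hψ]
  exact Language.Formula.realize_not

theorem imp (hp : FODefinable L ar p) (hq : FODefinable L ar q) :
    FODefinable L ar (fun M _ A s => p M A s → q M A s) := by
  obtain ⟨ψ, hψ⟩ := hp
  obtain ⟨θ, hθ⟩ := hq
  refine ⟨ψ.imp θ, fun M _ _ A s => ?_⟩
  let := indexedRelVarsStructure A
  beta_reduce
  rw [← hψ, ← hθ]
  exact Language.Formula.realize_imp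

theorem forall_finite {κ : Type} [Finite κ]
    {p : κ → ∀ (M : Type w) [L.Structure M], ((i : ι) → Set (Fin (ar i) → M)) → (α → M) → Prop}
    (hp : ∀ j, FODefinable L ar (p j)) : FODefinable L ar (fun M _ A s => ∀ j, p j M A s) := by
  choose ψ hψ using hp
  refine ⟨Language.BoundedFormula.iInf ψ, fun M _ _ A s => ?_⟩
  let := indexedRelVarsStructure A
  simp only [← hψ]
  exact Language.BoundedFormula.realize_iInf

theorem eq (t₁ t₂ : L.Term α) :
    FODefinable L ar (fun (M : Type w) _ _ (s : α → M) => t₁.realize s = t₂.realize s) := by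
  refine ⟨(Language.LHom.sumInl.onTerm t₁).equal (Language.LHom.sumInl.onTerm t₂),
    fun M _ _ A s => ?_⟩
  let := indexedRelVarsStructure A
  rw [Language.Formula.realize_equal, Language.LHom.realize_onTerm, Language.LHom.realize_onTerm]

theorem rel {m : ℕ} (R : L.Relations m) (t : Fin m → L.Term α) :
    FODefinable L ar (fun (M : Type w) _ _ (s : α → M) =>
      Language.Structure.RelMap R (fun j => (t j).realize s)) := by
  refine ⟨Language.Relations.formula (Language.LHom.sumInl.onRelation R)
    (fun j => Language.LHom.sumInl.onTerm (t j)), fun M _ _ A s => ?_⟩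
  let := indexedRelVarsStructure A
  rw [Language.Formula.realize_rel, Language.LHom.map_onRelation]
  simp only [Language.LHom.realize_onTerm]

theorem mem (i : ι) (t : Fin (ar i) → L.Term α) :
    FODefinable L ar (fun (M : Type w) _ A (s : α → M) => (fun j => (t j).realize s) ∈ A i) := by
  refine ⟨Language.Relations.formula (Language.LHom.sumInr.onRelation
    (⟨i, rfl⟩ : (indexedRelVars ar).Relations (ar i)))
    (fun j => Language.LHom.sumInl.onTerm (t j)), fun M _ _ A s => ?_⟩
  let := indexedRelVarsStructure A
  rw [Language.Formula.realize_rel]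
  simp only [Language.LHom.realize_onTerm]
  exact Iff.rfl

theorem reindex (hp : FODefinable L ar p) (f : α → β) :
    FODefinable L ar (fun M _ A (s : β → M) => p M A (s ∘ f)) := by
  obtain ⟨ψ, hψ⟩ := hp
  refine ⟨ψ.relabel f, fun M _ _ A s => ?_⟩
  let := indexedRelVarsStructure A
  beta_reduce
  rw [← hψ]
  exact Language.Formula.realize_relabel

theorem exists_block [Finite β]
    {p : ∀ (M : Type w) [L.Structure M], ((i : ι) → Set (Fin (ar i) → M)) → (α ⊕ β → M) → Prop}
    (hp : FODefinable L ar p) :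
    FODefinable L ar (fun M _ A s => ∃ b : β → M, p M A (Sum.elim s b)) := by
  obtain ⟨ψ, hψ⟩ := hp
  refine ⟨ψ.iExs β, fun M _ _ A s => ?_⟩
  let := indexedRelVarsStructure A
  simp only [← hψ]
  exact Language.Formula.realize_iExs

theorem forall_block [Finite β]
    {p : ∀ (M : Type w) [L.Structure M], ((i : ι) → Set (Fin (ar i) → M)) → (α ⊕ β → M) → Prop}
    (hp : FODefinable L ar p) :
    FODefinable L ar (fun M _ A s => ∀ b : β → M, p M A (Sum.elim s b)) := by
  obtain ⟨ψ, hψ⟩ := hp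
  refine ⟨ψ.iAlls β, fun M _ _ A s => ?_⟩
  let := indexedRelVarsStructure A
  simp only [← hψ]
  exact Language.Formula.realize_iAlls

theorem map_index (f : ι → ι') {ar' : ι' → ℕ}
    {p : ∀ (M : Type w) [L.Structure M], ((i : ι) → Set (Fin (ar' (f i)) → M)) → (α → M) → Prop}
    (hp : FODefinable L (fun i => ar' (f i)) p) :
    FODefinable L ar' (fun M _ A s => p M (fun i => A (f i)) s) := by
  obtain ⟨ψ, hψ⟩ := hp
  let g : indexedRelVars (fun i => ar' (f i)) →ᴸ indexedRelVars ar' :=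
    { onFunction := fun _ x => x
      onRelation := fun _ x => ⟨f x.1, x.2⟩ }
  refine ⟨((Language.LHom.id L).sumMap g).onFormula ψ, fun M _ _ A s => ?_⟩
  beta_reduce
  rw [← hψ]
  let := indexedRelVarsStructure A
  let := indexedRelVarsStructure (fun i => A (f i))
  have : g.IsExpansionOn M := ⟨fun x _ => Empty.elim x, fun x a => rfl⟩
  exact Language.LHom.realize_onFormula _ _

theorem exists_extend {V : Finset ℕ} {x : ℕ}
    {p : ∀ (M : Type w) [L.Structure M], ((i : ι) → Set (Fin (ar i) → M)) →
      (↥(insert x V) ⊕ β → M) → Prop}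
    (hp : FODefinable L ar p) :
    FODefinable L ar (fun M _ A (s : V ⊕ β → M) =>
      ∃ a, p M A (Sum.elim (extend (s ∘ Sum.inl) x a) (s ∘ Sum.inr))) := by
  -- `x` may already lie in `V`, so its old value must be overwritten: every occurrence of `x` is
  -- redirected to the new coordinate.
  let f : ↥(insert x V) ⊕ β → (V ⊕ β) ⊕ Unit :=
    Sum.elim (fun y => if h : y.1 = x then Sum.inr () else
      Sum.inl (Sum.inl ⟨y.1, Finset.mem_of_mem_insert_of_ne y.2 h⟩)) (fun b => Sum.inl (Sum.inr b))
  obtain ⟨ψ, hψ⟩ := (hp.reindex f).exists_block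
  refine ⟨ψ, fun M _ _ A s => ?_⟩
  have key : ∀ b : Unit → M, Sum.elim s b ∘ f =
      Sum.elim (extend (s ∘ Sum.inl) x (b ())) (s ∘ Sum.inr) := by
    intro b
    funext y
    rcases y with y | y
    · by_cases h : y.1 = x <;> simp [f, extend, h]
    · simp [f]
  rw [hψ]
  simp only [key]
  exact ⟨fun ⟨b, hb⟩ => ⟨b (), hb⟩, fun ⟨a, ha⟩ => ⟨fun _ => a, ha⟩⟩

end FODefinable

/-! ### Relational form of inclusion-exclusion formulas -/

/-- A team property has a relational form of arity `k` if it holds in `X` exactly when there are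
relations `A i` of arity at most `k` such that every `s ∈ X` has a certain first-order property,
and every tuple in `A i` is witnessed, in a first-order way, by some `s ∈ X`. -/
def HasRelationalForm (L : FirstOrder.Language.{u, v}) (k : ℕ) {V : Finset ℕ}
    (Q : ∀ (M : Type w) [L.Structure M], Set (V → M) → Prop) : Prop :=
  ∃ (ι : Type) (_ : Finite ι) (ar : ι → ℕ)
    (p : ∀ (M : Type w) [L.Structure M], ((i : ι) → Set (Fin (ar i) → M)) → (V → M) → Prop)
    (q : ∀ (j : ι) (M : Type w) [L.Structure M],
      ((i : ι) → Set (Fin (ar i) → M)) → (V ⊕ Fin (ar j) → M) → Prop),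
    (∀ i, ar i ≤ k) ∧ FODefinable L ar p ∧ (∀ j, FODefinable L ar (q j)) ∧
      ∀ (M : Type w) [Nonempty M] [L.Structure M] (X : Set (V → M)), Q M X ↔
        ∃ A : (i : ι) → Set (Fin (ar i) → M), (∀ s ∈ X, p M A s) ∧
          ∀ j, ∀ a ∈ A j, ∃ s ∈ X, q j M A (Sum.elim s a)

namespace HasRelationalForm

variable {L : FirstOrder.Language.{u, v}} {k : ℕ} {V : Finset ℕ}
  {Q Q' : ∀ (M : Type w) [L.Structure M], Set (V → M) → Prop}

theorem flat {p : ∀ (M : Type w) [L.Structure M], (V → M) → Prop}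
    (hp : FODefinable L (Empty.elim : Empty → ℕ) (fun M _ _ s => p M s)) :
    HasRelationalForm L k (fun M _ X => ∀ s ∈ X, p M s) :=
  ⟨Empty, inferInstance, Empty.elim, fun M _ _ s => p M s, fun j => j.elim, fun i => i.elim, hp,
    fun j => j.elim, fun _ _ _ _ => ⟨fun h => ⟨fun i => i.elim, h, fun j => j.elim⟩,
      fun ⟨_, h, _⟩ => h⟩⟩

/-- The relation is the set of values of `t₂`. The witness condition only bounds it from above by
that set, which suffices. -/
theorem incl {m : ℕ} (hm : m ≤ k) (t₁ t₂ : Fin m → L.Term V) :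
    HasRelationalForm L k (fun (M : Type w) _ (X : Set (V → M)) =>
      ∀ s ∈ X, ∃ s' ∈ X, tupleVal t₁ s = tupleVal t₂ s') := by
  refine ⟨Unit, inferInstance, fun _ => m, fun M _ A s => tupleVal t₁ s ∈ A (),
    fun _ M _ A s => ∀ i, (t₂ i).realize (s ∘ Sum.inl) = s (Sum.inr i), fun _ => hm,
    FODefinable.mem (ar := fun _ : Unit => m) () t₁, fun j => ?_, fun M _ _ X => ?_⟩
  · refine FODefinable.forall_finite fun i => ?_
    simpa only [Language.Term.realize_relabel, Language.Term.realize_var] using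
      FODefinable.eq ((t₂ i).relabel Sum.inl : L.Term (V ⊕ Fin m)) (Language.var (Sum.inr i))
  · constructor
    · intro h
      refine ⟨fun _ => {a | ∃ s' ∈ X, a = tupleVal t₂ s'}, h, ?_⟩
      rintro _ a ⟨s', hs', rfl⟩
      exact ⟨s', hs', fun i => rfl⟩
    · rintro ⟨A, h₁, h₂⟩ s hs
      obtain ⟨s', hs', h⟩ := h₂ () _ (h₁ s hs)
      exact ⟨s', hs', funext fun i => (h i).symm⟩

/-- A relation containing all values of `t₁` and no value of `t₂` separates them; the set of values
of `t₁` is the canonical one. -/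
theorem excl {m : ℕ} (hm : m ≤ k) (t₁ t₂ : Fin m → L.Term V) :
    HasRelationalForm L k (fun (M : Type w) _ (X : Set (V → M)) =>
      ∀ s ∈ X, ∀ s' ∈ X, tupleVal t₁ s ≠ tupleVal t₂ s') := by
  refine ⟨Unit, inferInstance, fun _ => m,
    fun M _ A s => tupleVal t₁ s ∈ A () ∧ ¬ tupleVal t₂ s ∈ A (),
    fun _ M _ A s => ∀ i, (t₁ i).realize (s ∘ Sum.inl) = s (Sum.inr i), fun _ => hm,
    (FODefinable.mem (ar := fun _ : Unit => m) () t₁).and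
      (FODefinable.mem (ar := fun _ : Unit => m) () t₂).not, fun j => ?_, fun M _ _ X => ?_⟩
  · refine FODefinable.forall_finite fun i => ?_
    simpa only [Language.Term.realize_relabel, Language.Term.realize_var] using
      FODefinable.eq ((t₁ i).relabel Sum.inl : L.Term (V ⊕ Fin m)) (Language.var (Sum.inr i))
  · constructor
    · intro h
      refine ⟨fun _ => {a | ∃ s' ∈ X, a = tupleVal t₁ s'}, fun s hs => ⟨⟨s, hs, rfl⟩, ?_⟩, ?_⟩
      · rintro ⟨s', hs', e⟩
        exact h s' hs' s hs e.symm
      · rintro _ a ⟨s', hs', rfl⟩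
        exact ⟨s', hs', fun i => rfl⟩
    · rintro ⟨A, h₁, -⟩ s hs s' hs' e
      exact (h₁ s' hs').2 (e ▸ (h₁ s hs).1)

theorem and (h : HasRelationalForm L k Q) (h' : HasRelationalForm L k Q') :
    HasRelationalForm L k (fun M _ X => Q M X ∧ Q' M X) := by
  obtain ⟨ι, _, ar, p, q, hk, hp, hq, hQ⟩ := h
  obtain ⟨ι', _, ar', p', q', hk', hp', hq', hQ'⟩ := h'
  refine ⟨ι ⊕ ι', inferInstance, Sum.elim ar ar',
    fun M _ A s => p M (fun i => A (Sum.inl i)) s ∧ p' M (fun i => A (Sum.inr i)) s,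
    fun j => match j with
      | Sum.inl j => fun M _ A s => q j M (fun i => A (Sum.inl i)) s
      | Sum.inr j => fun M _ A s => q' j M (fun i => A (Sum.inr i)) s,
    by rintro (i | i); exacts [hk i, hk' i],
    (hp.map_index Sum.inl (ar' := Sum.elim ar ar')).and
      (hp'.map_index Sum.inr (ar' := Sum.elim ar ar')), ?_, fun M _ _ X => ?_⟩
  · rintro (j | j)
    · exact (hq j).map_index Sum.inl (ar' := Sum.elim ar ar')
    · exact (hq' j).map_index Sum.inr (ar' := Sum.elim ar ar')
  · beta_reduce
    rw [hQ, hQ']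
    constructor
    · rintro ⟨⟨A, h₁, h₂⟩, A', h₁', h₂'⟩
      refine ⟨Sum.rec A A', fun s hs => ⟨h₁ s hs, h₁' s hs⟩, ?_⟩
      rintro (j | j)
      exacts [h₂ j, h₂' j]
    · rintro ⟨A, h₁, h₂⟩
      exact ⟨⟨fun i => A (Sum.inl i), fun s hs => (h₁ s hs).1, fun j => h₂ (Sum.inl j)⟩,
        fun i => A (Sum.inr i), fun s hs => (h₁ s hs).2, fun j => h₂ (Sum.inr j)⟩

/-- A witness for a tuple must come from the correct half of the team, so each witness condition is
strengthened by the membership condition of its half. -/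
theorem or (h : HasRelationalForm L k Q) (h' : HasRelationalForm L k Q') :
    HasRelationalForm L k (fun M _ X => ∃ Y Y', Y ⊆ X ∧ Y' ⊆ X ∧ Y ∪ Y' = X ∧ Q M Y ∧ Q' M Y') := by
  obtain ⟨ι, _, ar, p, q, hk, hp, hq, hQ⟩ := h
  obtain ⟨ι', _, ar', p', q', hk', hp', hq', hQ'⟩ := h'
  have dp := hp.map_index Sum.inl (ar' := Sum.elim ar ar')
  have dp' := hp'.map_index Sum.inr (ar' := Sum.elim ar ar')
  refine ⟨ι ⊕ ι', inferInstance, Sum.elim ar ar',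
    fun M _ A s => p M (fun i => A (Sum.inl i)) s ∨ p' M (fun i => A (Sum.inr i)) s,
    fun j => match j with
      | Sum.inl j => fun M _ A s => p M (fun i => A (Sum.inl i)) (s ∘ Sum.inl) ∧
          q j M (fun i => A (Sum.inl i)) s
      | Sum.inr j => fun M _ A s => p' M (fun i => A (Sum.inr i)) (s ∘ Sum.inl) ∧
          q' j M (fun i => A (Sum.inr i)) s,
    by rintro (i | i); exacts [hk i, hk' i], dp.or dp', ?_, fun M _ _ X => ?_⟩
  · rintro (j | j)
    · exact (dp.reindex Sum.inl).and ((hq j).map_index Sum.inl (ar' := Sum.elim ar ar'))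
    · exact (dp'.reindex Sum.inl).and ((hq' j).map_index Sum.inr (ar' := Sum.elim ar ar'))
  · simp only [hQ, hQ']
    constructor
    · rintro ⟨Y, Y', hY, hY', hX, ⟨A, h₁, h₂⟩, A', h₁', h₂'⟩
      refine ⟨Sum.rec A A', fun s hs => ?_, ?_⟩
      · rw [← hX] at hs
        exact hs.imp (h₁ s) (h₁' s)
      · rintro (j | j) a ha
        · obtain ⟨s, hs, e⟩ := h₂ j a ha
          exact ⟨s, hY hs, h₁ s hs, e⟩
        · obtain ⟨s, hs, e⟩ := h₂' j a ha
          exact ⟨s, hY' hs, h₁' s hs, e⟩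
    · rintro ⟨A, h₁, h₂⟩
      -- Both halves are taken as large as possible; enlarging a half only helps its witness
      -- conditions.
      refine ⟨{s ∈ X | p M (fun i => A (Sum.inl i)) s}, {s ∈ X | p' M (fun i => A (Sum.inr i)) s},
        fun s hs => hs.1, fun s hs => hs.1, ?_, ⟨fun i => A (Sum.inl i), fun s hs => hs.2, ?_⟩,
        fun i => A (Sum.inr i), fun s hs => hs.2, ?_⟩
      · ext s
        exact ⟨fun hs => hs.elim And.left And.left,
          fun hs => (h₁ s hs).imp (fun h => ⟨hs, h⟩) (fun h => ⟨hs, h⟩)⟩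
      · intro j a ha
        obtain ⟨s, hs, h, e⟩ := h₂ (Sum.inl j) a ha
        exact ⟨s, ⟨hs, h⟩, e⟩
      · intro j a ha
        obtain ⟨s, hs, h, e⟩ := h₂ (Sum.inr j) a ha
        exact ⟨s, ⟨hs, h⟩, e⟩

theorem exists_extend {ι : Type} {ar : ι → ℕ} {x : ℕ}
    {p : ∀ (M : Type w) [L.Structure M], ((i : ι) → Set (Fin (ar i) → M)) →
      (↥(insert x V) → M) → Prop} (hp : FODefinable L ar p) :
    FODefinable L ar (fun M _ A (s : V → M) => ∃ a, p M A (extend s x a)) :=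
  (FODefinable.exists_extend (hp.reindex (Sum.inl : _ → _ ⊕ Empty))).reindex
    (Sum.elim id Empty.elim)

/-- As for disjunction, the choice function may be taken maximal, collecting every value that
satisfies `p`, and witnesses must satisfy `p`. -/
theorem ex {x : ℕ} {Q : ∀ (M : Type w) [L.Structure M], Set (↥(insert x V) → M) → Prop}
    (h : HasRelationalForm L k Q) :
    HasRelationalForm L k (fun M _ (X : Set (V → M)) =>
      ∃ F : X → Set M, (∀ s, (F s).Nonempty) ∧ Q M (supplement X x F)) := by
  obtain ⟨ι, _, ar, p, q, hk, hp, hq, hQ⟩ := h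
  refine ⟨ι, inferInstance, ar, fun M _ A s => ∃ a, p M A (extend s x a),
    fun j M _ A s => ∃ a, p M A (extend (s ∘ Sum.inl) x a) ∧
      q j M A (Sum.elim (extend (s ∘ Sum.inl) x a) (s ∘ Sum.inr)), hk, exists_extend hp,
    fun j => FODefinable.exists_extend ((hp.reindex Sum.inl).and (hq j)), fun M _ _ X => ?_⟩
  simp only [hQ]
  constructor
  · rintro ⟨F, hF, A, h₁, h₂⟩
    refine ⟨A, fun s hs => ?_, fun j a ha => ?_⟩
    · obtain ⟨b, hb⟩ := hF ⟨s, hs⟩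
      exact ⟨b, h₁ _ ⟨⟨s, hs⟩, b, hb, rfl⟩⟩
    · obtain ⟨_, ⟨s, b, hb, rfl⟩, e⟩ := h₂ j a ha
      exact ⟨s.1, s.2, b, h₁ _ ⟨s, b, hb, rfl⟩, e⟩
  · rintro ⟨A, h₁, h₂⟩
    refine ⟨fun s => {a | p M A (extend s.1 x a)}, fun s => h₁ s.1 s.2, A, ?_, fun j a ha => ?_⟩
    · rintro _ ⟨s, a, ha, rfl⟩
      exact ha
    · obtain ⟨s, hs, b, hb, e⟩ := h₂ j a ha
      exact ⟨_, ⟨⟨s, hs⟩, b, hb, rfl⟩, e⟩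

theorem all {x : ℕ} {Q : ∀ (M : Type w) [L.Structure M], Set (↥(insert x V) → M) → Prop}
    (h : HasRelationalForm L k Q) :
    HasRelationalForm L k (fun M _ (X : Set (V → M)) =>
      Q M (supplement X x fun _ => Set.univ)) := by
  obtain ⟨ι, _, ar, p, q, hk, hp, hq, hQ⟩ := h
  refine ⟨ι, inferInstance, ar, fun M _ A s => ¬ ∃ a, ¬ p M A (extend s x a),
    fun j M _ A s => ∃ a, q j M A (Sum.elim (extend (s ∘ Sum.inl) x a) (s ∘ Sum.inr)), hk,
    (exists_extend hp.not).not, fun j => FODefinable.exists_extend (hq j), fun M _ _ X => ?_⟩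
  simp only [hQ, not_exists, not_not]
  refine exists_congr fun A => and_congr ?_ ?_
  · constructor
    · exact fun h s hs a => h _ ⟨⟨s, hs⟩, a, trivial, rfl⟩
    · rintro h _ ⟨s, a, -, rfl⟩
      exact h s.1 s.2 a
  · refine forall_congr' fun j => forall₂_congr fun a _ => ?_
    constructor
    · rintro ⟨_, ⟨s, b, -, rfl⟩, e⟩
      exact ⟨s.1, s.2, b, e⟩
    · rintro ⟨s, hs, b, e⟩
      exact ⟨_, ⟨⟨s, hs⟩, b, trivial, rfl⟩, e⟩

end HasRelationalForm

theorem TeamFormula.IsINEX.hasRelationalForm {L : FirstOrder.Language.{u, v}} {k : ℕ}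
    {V : Finset ℕ} {φ : TeamFormula L V} (h : φ.IsINEX k) :
    HasRelationalForm L k (fun (M : Type w) _ X => φ.Holds (M := M) X) := by
  induction φ with
  | eq t₁ t₂ => exact HasRelationalForm.flat (FODefinable.eq t₁ t₂)
  | neq t₁ t₂ => exact HasRelationalForm.flat (FODefinable.eq t₁ t₂).not
  | rel R t => exact HasRelationalForm.flat (FODefinable.rel R t)
  | nrel R t => exact HasRelationalForm.flat (FODefinable.rel R t).not
  | incl t₁ t₂ => exact HasRelationalForm.incl h t₁ t₂
  | excl t₁ t₂ => exact HasRelationalForm.excl h t₁ t₂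
  | and φ ψ ihφ ihψ => exact (ihφ h.1).and (ihψ h.2)
  | or φ ψ ihφ ihψ => exact (ihφ h.1).or (ihψ h.2)
  | ex x φ ih => exact (ih h).ex
  | all x φ ih => exact (ih h).all

/-! ### From relational form to `ESO[k]` sentences -/

/-- Truth of `k`-ary existential second-order sentences whose relation variables are indexed by an
arbitrary finite type. -/
theorem exists_esoSentence {L : FirstOrder.Language.{u, v}} {k : ℕ} {ι : Type} [Finite ι]
    {ar : ι → ℕ} (hk : ∀ i, ar i ≤ k) (ψ : (L.sum (indexedRelVars ar)).Sentence) :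
    ∃ Φ : ESOSentence L k, ∀ (M : Type w) [L.Structure M], Φ.TrueIn M ↔
      ∃ A : (i : ι) → Set (Fin (ar i) → M), letI := indexedRelVarsStructure A; M ⊨ ψ := by
  obtain ⟨n, ⟨e⟩⟩ := Finite.exists_equiv_fin ι
  let g : indexedRelVars ar →ᴸ relVars (fun i => ar (e.symm i)) :=
    { onFunction := fun _ x => x
      onRelation := fun _ x => ⟨e x.1, (congrArg ar (e.symm_apply_apply x.1)).trans x.2⟩ }
  refine ⟨⟨n, fun i => ar (e.symm i), fun i => hk _,
    ((Language.LHom.id L).sumMap g).onSentence ψ⟩, fun M _ => ?_⟩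
  have key : ∀ (A : (i : ι) → Set (Fin (ar i) → M)),
      (letI : (relVars (fun i => ar (e.symm i))).Structure M :=
        relVarsStructure (fun i => A (e.symm i))
      M ⊨ ((Language.LHom.id L).sumMap g).onSentence ψ) ↔
        (letI := indexedRelVarsStructure A; M ⊨ ψ) := by
    intro A
    let := indexedRelVarsStructure A
    let : (relVars (fun i => ar (e.symm i))).Structure M :=
      relVarsStructure (fun i => A (e.symm i))
    have : g.IsExpansionOn M := by
      refine ⟨fun x _ => Empty.elim x, ?_⟩
      rintro m ⟨i, rfl⟩ a
      -- Generalizing `e.symm (e i)` to `i'` lets the equality be eliminated together with the cast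
      -- of arities.
      have h : ∀ (i' : ι) (h : ar i' = ar i), i' = i →
          (((fun j => a (Fin.cast h j)) ∈ A i') = (a ∈ A i)) := by
        rintro i' h rfl
        rfl
      exact h _ (by rw [e.symm_apply_apply]) (e.symm_apply_apply i)
    exact Language.LHom.realize_onSentence M _ _
  constructor
  · rintro ⟨A, hA⟩
    have hB : ∃ B : (i : ι) → Set (Fin (ar i) → M), (fun i => B (e.symm i)) = A :=
      (Equiv.piCongrLeft' (fun i => Set (Fin (ar i) → M)) e).surjective A
    obtain ⟨B, rfl⟩ := hB
    exact ⟨B, (key B).1 hA⟩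
  · rintro ⟨A, hA⟩
    exact ⟨fun i => A (e.symm i), (key A).2 hA⟩

/-- In a one-element team the witness of a tuple must be the empty assignment, so the witness
conditions become first-order statements about the relations alone. -/
theorem TeamFormula.IsINEX.exists_esoSentence {L : FirstOrder.Language.{u, v}} {k : ℕ}
    {φ : TeamFormula L ∅} (h : φ.IsINEX k) :
    ∃ Φ : ESOSentence L k, ∀ (M : Type w) [Nonempty M] [L.Structure M],
      φ.TrueIn M ↔ Φ.TrueIn M := by
  obtain ⟨ι, _, ar, p, q, hk, hp, hq, hQ⟩ := h.hasRelationalForm.{u, v, w}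
  have hE : ∀ x : ↥(∅ : Finset ℕ), False := fun x => Finset.notMem_empty x.1 x.2
  have d : FODefinable L ar (fun (M : Type w) _ A (_ : Empty → M) =>
      p M A (emptyAssignment M) ∧ ∀ j, ∀ a : Fin (ar j) → M, a ∈ A j →
        q j M A (Sum.elim (emptyAssignment M) a)) := by
    have d₁ := hp.reindex (fun x => (hE x).elim : _ → Empty)
    have d₂ : ∀ j, FODefinable L ar (fun (M : Type w) _ A (s : Empty ⊕ Fin (ar j) → M) =>
        s ∘ Sum.inr ∈ A j → q j M A (s ∘ Sum.map (fun x => (hE x).elim) id)) := fun j =>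
      (FODefinable.mem j (fun i => Language.var (Sum.inr i))).imp ((hq j).reindex _)
    obtain ⟨ψ, hψ⟩ := d₁.and (FODefinable.forall_finite fun j => (d₂ j).forall_block)
    refine ⟨ψ, fun M _ _ A s => (hψ M A s).trans ?_⟩
    refine and_congr (iff_of_eq (congrArg _ (funext fun x => (hE x).elim))) ?_
    refine forall_congr' fun j => forall_congr' fun a => imp_congr Iff.rfl ?_
    refine iff_of_eq (congrArg _ (funext ?_))
    rintro (x | i)
    exacts [(hE x).elim, rfl]
  obtain ⟨ψ, hψ⟩ := d
  obtain ⟨Φ, hΦ⟩ := TeamLogic.exists_esoSentence.{u, v, w} hk ψ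
  refine ⟨Φ, fun M _ _ => ?_⟩
  rw [hΦ, TeamFormula.TrueIn]
  refine (hQ M _).trans ?_
  refine exists_congr fun A => ?_
  refine Iff.trans ?_ (hψ M A default).symm
  simp

/-! ### Team properties definable in `EXC[k]` -/

/-- A property of teams over an abstract set `α` of variables is definable in `EXC[k]` if, for each
way of naming the variables, an `EXC[k]` formula defines it in every nonempty structure. -/
def ExcDefinable (L : FirstOrder.Language.{u, v}) (k : ℕ) {α : Type}
    (Q : ∀ (M : Type w) [L.Structure M], Set (α → M) → Prop) : Prop :=
  ∀ (V : Finset ℕ) (e : α ≃ V), ∃ φ : TeamFormula L V, φ.IsEXC k ∧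
    ∀ (M : Type w) [Nonempty M] [L.Structure M] (X : Set (V → M)),
      φ.Holds X ↔ Q M ((fun s => s ∘ e) '' X)

namespace ExcDefinable

variable {L : FirstOrder.Language.{u, v}} {k : ℕ} {α β : Type}
  {Q Q' : ∀ (M : Type w) [L.Structure M], Set (α → M) → Prop}

theorem congr (hQ : ExcDefinable L k Q)
    (h : ∀ (M : Type w) [Nonempty M] [L.Structure M] (X : Set (α → M)), Q M X ↔ Q' M X) :
    ExcDefinable L k Q' := fun V e =>
  let ⟨φ, hφ, hφQ⟩ := hQ V e
  ⟨φ, hφ, fun M _ _ X => (hφQ M X).trans (h M _)⟩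

theorem reindex (hQ : ExcDefinable L k Q) (f : α ≃ β) :
    ExcDefinable L k (fun M _ (X : Set (β → M)) => Q M ((fun s => s ∘ f) '' X)) := fun V e =>
  let ⟨φ, hφ, hφQ⟩ := hQ V (f.trans e)
  ⟨φ, hφ, fun M _ _ X => by beta_reduce; rw [hφQ, Set.image_image]; rfl⟩

theorem and (hQ : ExcDefinable L k Q) (hQ' : ExcDefinable L k Q') :
    ExcDefinable L k (fun M _ X => Q M X ∧ Q' M X) := fun V e =>
  let ⟨φ, hφ, hφQ⟩ := hQ V e
  let ⟨ψ, hψ, hψQ⟩ := hQ' V e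
  ⟨φ.and ψ, ⟨hφ, hψ⟩, fun M _ _ X => and_congr (hφQ M X) (hψQ M X)⟩

theorem top : ExcDefinable L k (fun (M : Type w) _ (_ : Set (α → M)) => True) := fun V _ =>
  -- The bound variable guarantees a term even when `V` is empty and `L` has no constants.
  ⟨.all 0 (.eq (Language.var ⟨0, Finset.mem_insert_self 0 V⟩)
    (Language.var ⟨0, Finset.mem_insert_self 0 V⟩)), trivial,
    fun _ _ _ _ => iff_of_true (fun _ _ => rfl) trivial⟩

theorem forall_finite {κ : Type} [Finite κ] :
    ∀ {Q : κ → ∀ (M : Type w) [L.Structure M], Set (α → M) → Prop},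
      (∀ j, ExcDefinable L k (Q j)) → ExcDefinable L k (fun M _ X => ∀ j, Q j M X) := by
  induction κ using Finite.induction_empty_option with
  | of_equiv e ih =>
    intro Q hQ
    exact (ih fun j => hQ (e j)).congr fun M _ _ X => e.forall_congr_right (q := fun j => Q j M X)
  | h_empty => exact fun _ => top.congr fun M _ _ X => by simp
  | h_option ih =>
    intro Q hQ
    exact ((hQ none).and (ih fun j => hQ (some j))).congr fun M _ _ X =>
      (Option.forall (p := fun j => Q j M X)).symm

theorem imp_prop {c : Prop} (hQ : ExcDefinable L k Q) :
    ExcDefinable L k (fun M _ X => c → Q M X) := by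
  by_cases hc : c
  · exact hQ.congr fun M _ _ X => by simp [hc]
  · exact top.congr fun M _ _ X => by simp [hc]

theorem excl {m : ℕ} (hm : m ≤ k) (f g : Fin m → α) :
    ExcDefinable L k (fun (M : Type w) _ (X : Set (α → M)) =>
      ∀ s ∈ X, ∀ s' ∈ X, s ∘ f ≠ s' ∘ g) := fun V e => by
  refine ⟨.excl (fun j => Language.var (e (f j))) (fun j => Language.var (e (g j))), hm,
    fun M _ _ X => ?_⟩
  simp only [Set.forall_mem_image]
  exact Iff.rfl

/-- For flat properties, splitting the team amounts to a pointwise disjunction: send each assignment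
to every side whose property it has. -/
theorem flat_or {p q : ∀ (M : Type w) [L.Structure M], (α → M) → Prop}
    (hp : ExcDefinable L k (fun M _ X => ∀ s ∈ X, p M s))
    (hq : ExcDefinable L k (fun M _ X => ∀ s ∈ X, q M s)) :
    ExcDefinable L k (fun M _ X => ∀ s ∈ X, p M s ∨ q M s) := fun V e => by
  obtain ⟨φ, hφ, hφp⟩ := hp V e
  obtain ⟨ψ, hψ, hψq⟩ := hq V e
  refine ⟨φ.or ψ, ⟨hφ, hψ⟩, fun M _ _ X => ?_⟩
  simp only [TeamFormula.Holds, hφp, hψq, Set.forall_mem_image]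
  constructor
  · rintro ⟨Y, Y', -, -, rfl, h₁, h₂⟩ s (hs | hs)
    exacts [Or.inl (h₁ hs), Or.inr (h₂ hs)]
  · intro h
    refine ⟨{s ∈ X | p M (s ∘ e)}, {s ∈ X | q M (s ∘ e)}, fun s hs => hs.1, fun s hs => hs.1, ?_,
      fun s hs => hs.2, fun s hs => hs.2⟩
    ext s
    exact ⟨fun hs => hs.elim And.left And.left,
      fun hs => (h hs).imp (fun h => ⟨hs, h⟩) (fun h => ⟨hs, h⟩)⟩

end ExcDefinable

/-- Names for the variables `α ⊕ Unit`, given names for `α` and a fresh name. -/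
noncomputable def insertEquiv {α : Type} {V : Finset ℕ} (e : α ≃ V) {x : ℕ} (hx : x ∉ V) :
    α ⊕ Unit ≃ ↥(insert x V) :=
  Equiv.ofBijective
    (Sum.elim (fun a => ⟨e a, Finset.mem_insert_of_mem (e a).2⟩)
      (fun _ => ⟨x, Finset.mem_insert_self x V⟩)) <| by
    constructor
    · rintro (a | a) (b | b) h
      · simpa [Subtype.ext_iff] using h
      · exact absurd (by simpa using congrArg Subtype.val h) (ne_of_mem_of_not_mem (e a).2 hx)
      · exact absurd (by simpa using (congrArg Subtype.val h).symm)
          (ne_of_mem_of_not_mem (e b).2 hx)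
      · rfl
    · rintro ⟨y, hy⟩
      rcases Finset.mem_insert.1 hy with rfl | hy'
      · exact ⟨Sum.inr (), rfl⟩
      · exact ⟨Sum.inl (e.symm ⟨y, hy'⟩), by simp⟩

theorem extend_comp_insertEquiv {M : Type w} {α : Type} {V : Finset ℕ} (e : α ≃ V) {x : ℕ}
    (hx : x ∉ V) (s : V → M) (a : M) :
    extend s x a ∘ insertEquiv e hx = Sum.elim (s ∘ e) (fun _ => a) := by
  funext y
  rcases y with y | y
  · have : (e y).1 ≠ x := ne_of_mem_of_not_mem (e y).2 hx
    exact dif_neg this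
  · exact dif_pos rfl

namespace ExcDefinable

variable {L : FirstOrder.Language.{u, v}} {k : ℕ} {α β : Type}

/-- With a fresh variable, the supplements of `X` by nonempty-valued functions are exactly the teams
that project onto `X`. -/
theorem exists_unit {Q : ∀ (M : Type w) [L.Structure M], Set (α ⊕ Unit → M) → Prop}
    (hQ : ExcDefinable L k Q) :
    ExcDefinable L k (fun M _ (X : Set (α → M)) =>
      ∃ Y, (fun y => y ∘ Sum.inl) '' Y = X ∧ Q M Y) := fun V e => by
  obtain ⟨x, hx⟩ := Infinite.exists_notMem_finset V
  obtain ⟨φ, hφ, hφQ⟩ := hQ _ (insertEquiv e hx)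
  refine ⟨.ex x φ, hφ, fun M _ _ X => ?_⟩
  simp only [TeamFormula.Holds, hφQ]
  constructor
  · rintro ⟨F, hF, h⟩
    refine ⟨_, ?_, h⟩
    rw [Set.image_image]
    ext s
    constructor
    · rintro ⟨_, ⟨s, a, ha, rfl⟩, rfl⟩
      exact ⟨s, s.2, by simp only [extend_comp_insertEquiv, Sum.elim_comp_inl]⟩
    · rintro ⟨s, hs, rfl⟩
      obtain ⟨a, ha⟩ := hF ⟨s, hs⟩
      exact ⟨_, ⟨⟨s, hs⟩, a, ha, rfl⟩, by simp only [extend_comp_insertEquiv, Sum.elim_comp_inl]⟩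
  · rintro ⟨Y, hY, h⟩
    have hF : ∀ s : X, {a | Sum.elim (s.1 ∘ e) (fun _ => a) ∈ Y}.Nonempty := by
      intro s
      obtain ⟨y, hy, e'⟩ := hY.ge ⟨s.1, s.2, rfl⟩
      refine ⟨y (Sum.inr ()), ?_⟩
      beta_reduce at e'
      rw [← e']
      exact (Sum.elim_comp_inl_inr y).symm ▸ hy
    refine ⟨fun s => {a | Sum.elim (s.1 ∘ e) (fun _ => a) ∈ Y}, hF, ?_⟩
    convert h
    ext y
    constructor
    · rintro ⟨_, ⟨s, a, ha, rfl⟩, rfl⟩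
      beta_reduce
      rw [extend_comp_insertEquiv]
      exact ha
    · intro hy
      obtain ⟨s, hs, e'⟩ := hY.le ⟨y, hy, rfl⟩
      have hy' : Sum.elim (s ∘ e) (fun _ => y (Sum.inr ())) = y := by
        beta_reduce at e'
        rw [e']
        exact Sum.elim_comp_inl_inr y
      refine ⟨_, ⟨⟨s, hs⟩, y (Sum.inr ()), ?_, rfl⟩, ?_⟩
      · exact hy'.symm ▸ hy
      · simpa only [extend_comp_insertEquiv] using hy'

theorem forall_unit {Q : ∀ (M : Type w) [L.Structure M], Set (α ⊕ Unit → M) → Prop}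
    (hQ : ExcDefinable L k Q) :
    ExcDefinable L k (fun M _ (X : Set (α → M)) => Q M ((fun y => y ∘ Sum.inl) ⁻¹' X)) :=
  fun V e => by
  obtain ⟨x, hx⟩ := Infinite.exists_notMem_finset V
  obtain ⟨φ, hφ, hφQ⟩ := hQ _ (insertEquiv e hx)
  refine ⟨.all x φ, hφ, fun M _ _ X => ?_⟩
  simp only [TeamFormula.Holds, hφQ]
  refine iff_of_eq (congrArg _ ?_)
  ext y
  constructor
  · rintro ⟨_, ⟨s, a, -, rfl⟩, rfl⟩
    exact ⟨s, s.2, by simp only [extend_comp_insertEquiv, Sum.elim_comp_inl]⟩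
  · rintro ⟨s, hs, e'⟩
    refine ⟨_, ⟨⟨s, hs⟩, y (Sum.inr ()), trivial, rfl⟩, ?_⟩
    beta_reduce at e'
    simp only [extend_comp_insertEquiv, e']
    exact Sum.elim_comp_inl_inr y

/-- The variables `(α ⊕ β) ⊕ Unit` regrouped as `α ⊕ Option β`. -/
def regroupOption (α β : Type) : (α ⊕ Unit) ⊕ β ≃ α ⊕ Option β :=
  (Equiv.sumAssoc α Unit β).trans
    (Equiv.sumCongr (Equiv.refl α) ((Equiv.sumComm Unit β).trans (Equiv.optionEquivSumPUnit β).symm))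

theorem exists_block [Finite β] :
    ∀ {α : Type} {Q : ∀ (M : Type w) [L.Structure M], Set (α ⊕ β → M) → Prop},
      ExcDefinable L k Q → ExcDefinable L k (fun M _ (X : Set (α → M)) =>
        ∃ Y, (fun y => y ∘ Sum.inl) '' Y = X ∧ Q M Y) := by
  have key : ∀ {α γ δ : Type} (f : α ⊕ γ ≃ δ) (Q : ∀ (M : Type w) [L.Structure M],
      Set (δ → M) → Prop) (M : Type w) [L.Structure M] (X : Set (α → M)),
      (∃ Y : Set (α ⊕ γ → M), (fun y => y ∘ Sum.inl) '' Y = X ∧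
        Q M ((fun y => y ∘ f.symm) '' Y)) ↔
      ∃ Y : Set (δ → M), (fun y => y ∘ f ∘ Sum.inl) '' Y = X ∧ Q M Y := by
    intro α γ δ f Q M _ X
    constructor
    · rintro ⟨Y, hY, h⟩
      refine ⟨_, ?_, h⟩
      rw [← hY, Set.image_image]
      refine Set.image_congr fun y _ => funext fun a => ?_
      simp
    · rintro ⟨Y, hY, h⟩
      refine ⟨(fun y => y ∘ f) '' Y, by rw [← hY, Set.image_image]; rfl, ?_⟩
      rw [Set.image_image]
      simpa [Function.comp_assoc] using h
  induction β using Finite.induction_empty_option with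
  | of_equiv e ih =>
    intro α Q hQ
    let f := Equiv.sumCongr (Equiv.refl α) e
    exact (ih (hQ.reindex f.symm)).congr fun M _ _ X => key f Q M X
  | h_empty =>
    intro α Q hQ
    let f := Equiv.sumEmpty α PEmpty
    refine (hQ.reindex f).congr fun M _ _ X => ?_
    constructor
    · refine fun h => ⟨_, ?_, h⟩
      rw [Set.image_image]
      exact Set.image_id X
    · rintro ⟨Y, rfl, h⟩
      rw [Set.image_image]
      convert h
      refine (Set.image_congr fun y _ => ?_).trans (Set.image_id Y)
      funext a
      rcases a with a | a
      exacts [rfl, a.elim]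
  | h_option ih =>
    intro α Q hQ
    rename_i β _
    refine (exists_unit (ih (hQ.reindex (regroupOption α β).symm))).congr fun M _ _ X => ?_
    refine Iff.trans ?_ (key (γ := Option β) (Equiv.refl _) Q M X)
    constructor
    · rintro ⟨Z, hZ, Y, hY, h⟩
      refine ⟨(fun y => y ∘ (regroupOption α β).symm) '' Y, ?_, by simpa using h⟩
      rw [← hZ, ← hY, Set.image_image, Set.image_image]
      rfl
    · rintro ⟨Y, hY, h⟩
      -- The intermediate team, after the first quantifier, is recovered as the projection of the
      -- final one.
      refine ⟨_, ?_, (fun y => y ∘ regroupOption α β) '' Y, rfl, ?_⟩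
      · rw [← hY, Set.image_image, Set.image_image]
        rfl
      · rw [Set.image_image]
        simpa [Function.comp_assoc] using h

theorem forall_block [Finite β] :
    ∀ {α : Type} {Q : ∀ (M : Type w) [L.Structure M], Set (α ⊕ β → M) → Prop},
      ExcDefinable L k Q → ExcDefinable L k (fun M _ (X : Set (α → M)) =>
        Q M ((fun y => y ∘ Sum.inl) ⁻¹' X)) := by
  have key : ∀ {γ δ : Type} (f : γ ≃ δ) (M : Type w) (Y : Set (γ → M)),
      (fun y : γ → M => y ∘ f.symm) '' Y = (fun y : δ → M => y ∘ f) ⁻¹' Y := by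
    intro γ δ f M Y
    ext y
    constructor
    · rintro ⟨y, hy, rfl⟩
      simpa [Function.comp_assoc] using hy
    · exact fun hy => ⟨_, hy, by simp [Function.comp_assoc]⟩
  induction β using Finite.induction_empty_option with
  | of_equiv e ih =>
    intro α Q hQ
    let f := Equiv.sumCongr (Equiv.refl α) e
    refine (ih (hQ.reindex f.symm)).congr fun M _ _ X => ?_
    rw [key]
    rfl
  | h_empty =>
    intro α Q hQ
    let f := Equiv.sumEmpty α PEmpty
    refine (hQ.reindex f).congr fun M _ _ X => ?_
    rw [← f.symm_symm, key]
    rfl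
  | h_option ih =>
    intro α Q hQ
    rename_i β _
    refine (forall_unit (ih (hQ.reindex (regroupOption α β).symm))).congr fun M _ _ X => ?_
    rw [key]
    rfl

end ExcDefinable

/-! ### Flat properties -/

/-- A property of assignments such that, under every renaming of the variables, the teams all of
whose members have the property are definable in `EXC[k]`. -/
def FlatDefinable (L : FirstOrder.Language.{u, v}) (k : ℕ) {α : Type}
    (p : ∀ (M : Type w) [L.Structure M], (α → M) → Prop) : Prop :=
  ∀ (β : Type) (f : α → β), ExcDefinable L k (fun M _ (X : Set (β → M)) => ∀ s ∈ X, p M (s ∘ f))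

theorem tupleVal_relabel {L : FirstOrder.Language.{u, v}} {M : Type w} [L.Structure M] {α : Type}
    {V : Finset ℕ} {m : ℕ} (t : Fin m → L.Term α) (f : α → V) (s : V → M) :
    tupleVal (fun j => (t j).relabel f) s = fun j => (t j).realize (s ∘ f) :=
  funext fun _ => Language.Term.realize_relabel

namespace FlatDefinable

variable {L : FirstOrder.Language.{u, v}} {k : ℕ} {α β : Type}
  {p q : ∀ (M : Type w) [L.Structure M], (α → M) → Prop}

theorem excDefinable (hp : FlatDefinable L k p) :
    ExcDefinable L k (fun M _ X => ∀ s ∈ X, p M s) := hp α id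

/-- `ExcDefinable` is transported along bijections only; building arbitrary maps into the definition
makes this closure a composition. -/
theorem reindex (hp : FlatDefinable L k p) (f : α → β) :
    FlatDefinable L k (fun M _ (s : β → M) => p M (s ∘ f)) := fun γ g => hp γ (g ∘ f)

theorem or (hp : FlatDefinable L k p) (hq : FlatDefinable L k q) :
    FlatDefinable L k (fun M _ s => p M s ∨ q M s) := fun β f => (hp β f).flat_or (hq β f)

theorem and (hp : FlatDefinable L k p) (hq : FlatDefinable L k q) :
    FlatDefinable L k (fun M _ s => p M s ∧ q M s) := fun β f =>
  ((hp β f).and (hq β f)).congr fun _ _ _ _ =>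
    ⟨fun h s hs => ⟨h.1 s hs, h.2 s hs⟩, fun h => ⟨fun s hs => (h s hs).1, fun s hs => (h s hs).2⟩⟩

theorem forall_finite {κ : Type} [Finite κ]
    {p : κ → ∀ (M : Type w) [L.Structure M], (α → M) → Prop}
    (hp : ∀ j, FlatDefinable L k (p j)) : FlatDefinable L k (fun M _ s => ∀ j, p j M s) := fun β f =>
  (ExcDefinable.forall_finite fun j => hp j β f).congr fun _ _ _ _ =>
    ⟨fun h s hs j => h j s hs, fun h j s hs => h s hs j⟩

theorem const (c : Prop) : FlatDefinable L k (fun (M : Type w) _ (_ : α → M) => c) := fun β f => by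
  by_cases hc : c
  · exact ExcDefinable.top.congr fun M _ _ X => by simp [hc]
  · refine (ExcDefinable.excl (Nat.zero_le k) Fin.elim0 Fin.elim0).congr fun M _ _ X => ?_
    exact ⟨fun h s hs => (h s hs s hs (funext fun i => i.elim0)).elim,
      fun h s hs => (hc (h s hs)).elim⟩

theorem eq (t₁ t₂ : L.Term α) :
    FlatDefinable L k (fun (M : Type w) _ (s : α → M) => t₁.realize s = t₂.realize s) :=
  fun _ f V e => ⟨.eq (t₁.relabel (e ∘ f)) (t₂.relabel (e ∘ f)), trivial, fun M _ _ X => by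
    simp only [TeamFormula.Holds, Set.forall_mem_image, Language.Term.realize_relabel,
      Function.comp_assoc]⟩

theorem neq (t₁ t₂ : L.Term α) :
    FlatDefinable L k (fun (M : Type w) _ (s : α → M) => ¬ t₁.realize s = t₂.realize s) :=
  fun _ f V e => ⟨.neq (t₁.relabel (e ∘ f)) (t₂.relabel (e ∘ f)), trivial, fun M _ _ X => by
    simp only [TeamFormula.Holds, Set.forall_mem_image, Language.Term.realize_relabel,
      Function.comp_assoc, ne_eq]⟩

theorem rel {m : ℕ} (R : L.Relations m) (t : Fin m → L.Term α) :
    FlatDefinable L k (fun (M : Type w) _ (s : α → M) =>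
      Language.Structure.RelMap R (fun j => (t j).realize s)) :=
  fun _ f V e => ⟨.rel R (fun j => (t j).relabel (e ∘ f)), trivial, fun M _ _ X => by
    simp only [TeamFormula.Holds, tupleVal_relabel, Set.forall_mem_image, Function.comp_assoc]⟩

theorem nrel {m : ℕ} (R : L.Relations m) (t : Fin m → L.Term α) :
    FlatDefinable L k (fun (M : Type w) _ (s : α → M) =>
      ¬ Language.Structure.RelMap R (fun j => (t j).realize s)) :=
  fun _ f V e => ⟨.nrel R (fun j => (t j).relabel (e ∘ f)), trivial, fun M _ _ X => by
    simp only [TeamFormula.Holds, tupleVal_relabel, Set.forall_mem_image, Function.comp_assoc]⟩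

end FlatDefinable

/-! ### Pulling relation literals out of quantifier-free formulas -/

/-- The relations `A i` are as prescribed by `σ`: `σ i = some true` asks that `A i` is everything,
`σ i = some false` that it is empty, and `σ i = none` that neither is the case. -/
def Fits {M : Type w} {n : ℕ} {ar : Fin n → ℕ} (σ : Fin n → Option Bool)
    (A : (i : Fin n) → Set (Fin (ar i) → M)) : Prop :=
  (∀ i, σ i = none → (∃ a, a ∈ A i) ∧ ∃ a, a ∉ A i) ∧
    ∀ i b, σ i = some b → ∀ a, a ∈ A i ↔ b = true

theorem exists_fits {M : Type w} {n : ℕ} {ar : Fin n → ℕ}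
    (A : (i : Fin n) → Set (Fin (ar i) → M)) : ∃ σ, Fits σ A := by
  have h : ∀ i, ∃ o : Option Bool, (o = none → (∃ a, a ∈ A i) ∧ ∃ a, a ∉ A i) ∧
      ∀ b, o = some b → ∀ a, a ∈ A i ↔ b = true := by
    intro i
    by_cases h₁ : ∃ a, a ∈ A i
    · by_cases h₂ : ∃ a, a ∉ A i
      · exact ⟨none, fun _ => ⟨h₁, h₂⟩, nofun⟩
      · push Not at h₂
        refine ⟨some true, nofun, ?_⟩
        rintro _ ⟨⟩ a
        exact iff_of_true (h₂ a) rfl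
    · push Not at h₁
      refine ⟨some false, nofun, ?_⟩
      rintro _ ⟨⟩ a
      exact iff_of_false (h₁ a) Bool.false_ne_true
  choose σ hσ using h
  exact ⟨σ, fun i => (hσ i).1, fun i => (hσ i).2⟩

/-- Provides the dummy tuples for literals of a disjunct that is not chosen. -/
theorem Fits.exists_mem_iff {M : Type w} {n : ℕ} {ar : Fin n → ℕ} {σ : Fin n → Option Bool}
    {A : (i : Fin n) → Set (Fin (ar i) → M)} (h : Fits σ A) {i : Fin n} (hi : σ i = none)
    (c : Bool) : ∃ a, a ∈ A i ↔ c = true := by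
  cases c
  · obtain ⟨a, ha⟩ := (h.1 i hi).2
    exact ⟨a, iff_of_false ha Bool.false_ne_true⟩
  · obtain ⟨a, ha⟩ := (h.1 i hi).1
    exact ⟨a, iff_of_true ha rfl⟩

/-- A property of assignments, depending on relations `A i` that fit `σ`, is literal-definable if it
says that there are tuples, each required to be in, or outside, one of the nontrivial `A i`, that
have a certain `A`-independent flat property. -/
def LiteralDefinable (L : FirstOrder.Language.{u, v}) (k : ℕ) {n : ℕ} (ar : Fin n → ℕ)
    (σ : Fin n → Option Bool) {α : Type}
    (p : ∀ (M : Type w) [L.Structure M], ((i : Fin n) → Set (Fin (ar i) → M)) → (α → M) → Prop) :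
    Prop :=
  ∃ (J : Type) (_ : Finite J) (r : J → Fin n) (c : J → Bool)
    (q : ∀ (M : Type w) [L.Structure M], (α ⊕ (Σ j, Fin (ar (r j))) → M) → Prop),
    (∀ j, σ (r j) = none) ∧ FlatDefinable L k q ∧
      ∀ (M : Type w) [Nonempty M] [L.Structure M] (A : (i : Fin n) → Set (Fin (ar i) → M)),
        Fits σ A → ∀ s, p M A s ↔ ∃ b : (Σ j, Fin (ar (r j))) → M, q M (Sum.elim s b) ∧
          ∀ j, (fun l => b ⟨j, l⟩) ∈ A (r j) ↔ c j = true

namespace LiteralDefinable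

variable {L : FirstOrder.Language.{u, v}} {k n : ℕ} {ar : Fin n → ℕ} {σ : Fin n → Option Bool}
  {α : Type}
  {p p' : ∀ (M : Type w) [L.Structure M], ((i : Fin n) → Set (Fin (ar i) → M)) → (α → M) → Prop}

theorem congr (hp : LiteralDefinable L k ar σ p)
    (h : ∀ (M : Type w) [Nonempty M] [L.Structure M] (A : (i : Fin n) → Set (Fin (ar i) → M)),
      Fits σ A → ∀ s, p M A s ↔ p' M A s) : LiteralDefinable L k ar σ p' := by
  obtain ⟨J, hJ, r, c, q, hr, hq, hpq⟩ := hp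
  exact ⟨J, hJ, r, c, q, hr, hq, fun M _ _ A hA s => (h M A hA s).symm.trans (hpq M A hA s)⟩

theorem of_flat {p : ∀ (M : Type w) [L.Structure M], (α → M) → Prop} (hp : FlatDefinable L k p) :
    LiteralDefinable L k ar σ (fun M _ _ s => p M s) :=
  ⟨Empty, inferInstance, Empty.elim, Empty.elim, fun M _ s => p M (s ∘ Sum.inl), fun j => j.elim,
    hp.reindex Sum.inl, fun _ _ _ _ _ _ => ⟨fun h => ⟨fun x => x.1.elim, h, fun j => j.elim⟩,
      fun ⟨_, h, _⟩ => h⟩⟩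

/-- If `A i` is nontrivial, a new tuple equal to `t` carries the literal; otherwise `σ` already
decides its truth value. -/
theorem literal (c : Bool) (i : Fin n) (t : Fin (ar i) → L.Term α) :
    LiteralDefinable L k ar σ (fun (M : Type w) _ A (s : α → M) =>
      (fun l => (t l).realize s) ∈ A i ↔ c = true) := by
  rcases hi : σ i with _ | b
  · refine ⟨Unit, inferInstance, fun _ => i, fun _ => c,
      fun M _ s => ∀ l, (t l).realize (s ∘ Sum.inl) = s (Sum.inr ⟨(), l⟩), fun _ => hi,
      FlatDefinable.forall_finite fun l => ?_, fun M _ _ A hA s => ?_⟩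
    · simpa only [Language.Term.realize_relabel, Language.Term.realize_var] using
        FlatDefinable.eq ((t l).relabel Sum.inl : L.Term (α ⊕ (Σ _ : Unit, Fin (ar i))))
          (Language.var (Sum.inr ⟨(), l⟩))
    · constructor
      · exact fun h => ⟨fun x => (t x.2).realize s, fun l => rfl, fun _ => h⟩
      · rintro ⟨b, hb, h⟩
        have e : (fun l => (t l).realize s) = fun l => b ⟨(), l⟩ := funext hb
        rw [e]
        exact h ()
  · exact (of_flat (FlatDefinable.const (b = true ↔ c = true))).congr fun M _ _ A hA s =>
      iff_congr (hA.2 i b hi _).symm Iff.rfl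

section

variable {J J' : Type} {r : J → Fin n} {r' : J' → Fin n}

/-- The inclusion of the first of two blocks of tuple variables. -/
def blockInl (x : α ⊕ (Σ j, Fin (ar (r j)))) : α ⊕ (Σ j, Fin (ar (Sum.elim r r' j))) :=
  x.map id (fun y => ⟨Sum.inl y.1, y.2⟩)

/-- The inclusion of the second of two blocks of tuple variables. -/
def blockInr (x : α ⊕ (Σ j, Fin (ar (r' j)))) : α ⊕ (Σ j, Fin (ar (Sum.elim r r' j))) :=
  x.map id (fun y => ⟨Sum.inr y.1, y.2⟩)

/-- The values of two blocks of tuple variables together. -/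
def blockElim {M : Type w} (b : (Σ j, Fin (ar (r j))) → M) (b' : (Σ j, Fin (ar (r' j))) → M) :
    (Σ j, Fin (ar (Sum.elim r r' j))) → M
  | ⟨Sum.inl j, l⟩ => b ⟨j, l⟩
  | ⟨Sum.inr j, l⟩ => b' ⟨j, l⟩

theorem elim_blockElim_comp_inl {M : Type w} (s : α → M) (b : (Σ j, Fin (ar (r j))) → M)
    (b' : (Σ j, Fin (ar (r' j))) → M) :
    Sum.elim s (blockElim b b') ∘ blockInl = Sum.elim s b := by
  funext x
  rcases x with x | ⟨j, l⟩ <;> rfl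

theorem elim_blockElim_comp_inr {M : Type w} (s : α → M) (b : (Σ j, Fin (ar (r j))) → M)
    (b' : (Σ j, Fin (ar (r' j))) → M) :
    Sum.elim s (blockElim b b') ∘ blockInr = Sum.elim s b' := by
  funext x
  rcases x with x | ⟨j, l⟩ <;> rfl

theorem exists_eq_blockElim {M : Type w} (b : (Σ j, Fin (ar (Sum.elim r r' j))) → M) :
    ∃ (b₁ : (Σ j, Fin (ar (r j))) → M) (b₂ : (Σ j, Fin (ar (r' j))) → M), b = blockElim b₁ b₂ := by
  refine ⟨fun x => b ⟨Sum.inl x.1, x.2⟩, fun x => b ⟨Sum.inr x.1, x.2⟩, funext ?_⟩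
  rintro ⟨j | j, l⟩ <;> rfl

end

theorem and (hp : LiteralDefinable L k ar σ p) (hp' : LiteralDefinable L k ar σ p') :
    LiteralDefinable L k ar σ (fun M _ A s => p M A s ∧ p' M A s) := by
  obtain ⟨J, _, r, c, q, hr, hq, hpq⟩ := hp
  obtain ⟨J', _, r', c', q', hr', hq', hpq'⟩ := hp'
  refine ⟨J ⊕ J', inferInstance, Sum.elim r r', Sum.elim c c',
    fun M _ s => q M (s ∘ blockInl) ∧ q' M (s ∘ blockInr),
    by rintro (j | j); exacts [hr j, hr' j], (hq.reindex _).and (hq'.reindex _),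
    fun M _ _ A hA s => ?_⟩
  beta_reduce
  rw [hpq M A hA, hpq' M A hA]
  constructor
  · rintro ⟨⟨b, h, hb⟩, b', h', hb'⟩
    refine ⟨blockElim b b', ?_, ?_⟩
    · rw [elim_blockElim_comp_inl, elim_blockElim_comp_inr]
      exact ⟨h, h'⟩
    · rintro (j | j)
      exacts [hb j, hb' j]
  · rintro ⟨b, h, hb⟩
    obtain ⟨b₁, b₂, rfl⟩ := exists_eq_blockElim b
    rw [elim_blockElim_comp_inl, elim_blockElim_comp_inr] at h
    exact ⟨⟨b₁, h.1, fun j => hb (Sum.inl j)⟩, b₂, h.2, fun j => hb (Sum.inr j)⟩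

/-- The literal requirements of both disjuncts are imposed at once and only the flat parts are
disjoined. Those of the disjunct that fails are met by dummy tuples, which is where nontriviality of
the relations is used. -/
theorem or (hp : LiteralDefinable L k ar σ p) (hp' : LiteralDefinable L k ar σ p') :
    LiteralDefinable L k ar σ (fun M _ A s => p M A s ∨ p' M A s) := by
  obtain ⟨J, _, r, c, q, hr, hq, hpq⟩ := hp
  obtain ⟨J', _, r', c', q', hr', hq', hpq'⟩ := hp'
  refine ⟨J ⊕ J', inferInstance, Sum.elim r r', Sum.elim c c',
    fun M _ s => q M (s ∘ blockInl) ∨ q' M (s ∘ blockInr),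
    by rintro (j | j); exacts [hr j, hr' j], (hq.reindex _).or (hq'.reindex _),
    fun M _ _ A hA s => ?_⟩
  beta_reduce
  rw [hpq M A hA, hpq' M A hA]
  constructor
  · rintro (⟨b, h, hb⟩ | ⟨b', h', hb'⟩)
    · choose d hd using fun j => hA.exists_mem_iff (hr' j) (c' j)
      refine ⟨blockElim b (fun x => d x.1 x.2), Or.inl ?_, ?_⟩
      · rwa [elim_blockElim_comp_inl]
      · rintro (j | j)
        exacts [hb j, hd j]
    · choose d hd using fun j => hA.exists_mem_iff (hr j) (c j)
      refine ⟨blockElim (fun x => d x.1 x.2) b', Or.inr ?_, ?_⟩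
      · rwa [elim_blockElim_comp_inr]
      · rintro (j | j)
        exacts [hd j, hb' j]
  · rintro ⟨b, h, hb⟩
    obtain ⟨b₁, b₂, rfl⟩ := exists_eq_blockElim b
    rw [elim_blockElim_comp_inl, elim_blockElim_comp_inr] at h
    exact h.imp (fun h => ⟨b₁, h, fun j => hb (Sum.inl j)⟩)
      (fun h => ⟨b₂, h, fun j => hb (Sum.inr j)⟩)

end LiteralDefinable

/-- The relation symbols `P i` do not occur in terms. -/
theorem exists_term_realize_eq {L : FirstOrder.Language.{u, v}} {n : ℕ} {ar : Fin n → ℕ}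
    {α : Type} (t : (L.sum (relVars ar)).Term α) :
    ∃ t' : L.Term α, ∀ (M : Type w) [L.Structure M] (A : (i : Fin n) → Set (Fin (ar i) → M))
      (s : α → M), (letI := relVarsStructure A; t.realize s) = t'.realize s := by
  induction t with
  | var x => exact ⟨Language.var x, fun _ _ _ _ => rfl⟩
  | func f ts ih =>
    choose ts' h using ih
    rcases f with f | f
    · refine ⟨Language.func f ts', fun M _ A s => ?_⟩
      exact congrArg (Language.Structure.funMap f) (funext fun i => h i M A s)
    · exact Empty.elim f

/-- Formulas are built from falsity and implication, so both polarities are carried through the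
induction, which amounts to negation normal form. -/
theorem LiteralDefinable.of_isQF {L : FirstOrder.Language.{u, v}} {k n N : ℕ} {ar : Fin n → ℕ}
    (σ : Fin n → Option Bool) {α : Type} (g : Fin N → α)
    {δ : (L.sum (relVars ar)).BoundedFormula Empty N} (h : δ.IsQF) :
    LiteralDefinable L k ar σ (fun (M : Type w) _ A (s : α → M) =>
      letI := relVarsStructure A; δ.Realize default (s ∘ g)) ∧
    LiteralDefinable L k ar σ (fun (M : Type w) _ A (s : α → M) =>
      letI := relVarsStructure A; ¬ δ.Realize default (s ∘ g)) := by
  have term : ∀ t : (L.sum (relVars ar)).Term (Empty ⊕ Fin N), ∃ t' : L.Term α,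
      ∀ (M : Type w) [L.Structure M] (A : (i : Fin n) → Set (Fin (ar i) → M)) (s : α → M),
        (letI := relVarsStructure A; t.realize (Sum.elim default (s ∘ g))) = t'.realize s := by
    intro t
    obtain ⟨t', ht'⟩ := exists_term_realize_eq.{u, v, w} t
    refine ⟨t'.relabel (Sum.elim Empty.elim g), fun M _ A s => ?_⟩
    rw [ht', Language.Term.realize_relabel]
    congr 1
    funext x
    rcases x with x | x
    exacts [x.elim, rfl]
  induction h with
  | falsum =>
    exact ⟨(of_flat (FlatDefinable.const False)).congr fun M _ _ A _ s => Iff.rfl,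
      (of_flat (FlatDefinable.const True)).congr fun M _ _ A _ s => not_false_iff.symm⟩
  | of_isAtomic h =>
    cases h with
    | equal t₁ t₂ =>
      obtain ⟨t₁', h₁⟩ := term t₁
      obtain ⟨t₂', h₂⟩ := term t₂
      refine ⟨(of_flat (FlatDefinable.eq t₁' t₂')).congr fun M _ _ A _ s => ?_,
        (of_flat (FlatDefinable.neq t₁' t₂')).congr fun M _ _ A _ s => not_congr ?_⟩ <;>
      · rw [← h₁ M A s, ← h₂ M A s]
        exact Iff.rfl
    | rel R ts =>
      choose t h using fun j => term (ts j)
      rcases R with R | R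
      · refine ⟨(of_flat (FlatDefinable.rel R t)).congr fun M _ _ A _ s => ?_,
          (of_flat (FlatDefinable.nrel R t)).congr fun M _ _ A _ s => not_congr ?_⟩ <;>
        · simp only [← h _ M A s]
          exact Iff.rfl
      · obtain ⟨i, rfl⟩ := R
        refine ⟨(literal true i t).congr fun M _ _ A _ s => ?_,
          (literal false i t).congr fun M _ _ A _ s => ?_⟩
        · simp only [← h _ M A s, iff_true]
          exact Iff.rfl
        · simp only [← h _ M A s, Bool.false_eq_true, iff_false]
          exact Iff.rfl
  | imp _ _ ih₁ ih₂ =>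
    refine ⟨(ih₁.2.or ih₂.1).congr fun M _ _ A _ s => ?_,
      (ih₁.1.and ih₂.2).congr fun M _ _ A _ s => ?_⟩
    · exact imp_iff_not_or.symm
    · exact Classical.not_imp.symm

/-! ### Teams that represent relations, and prenex formulas -/

/-- The values of the variables `w ⟨i, ·⟩`. -/
def blockVal {M : Type w} {n : ℕ} {ar : Fin n → ℕ} {α : Type} (w : (Σ i, Fin (ar i)) → α)
    (i : Fin n) (s : α → M) : Fin (ar i) → M :=
  s ∘ fun l => w ⟨i, l⟩

/-- In the team `X`, the values of `w ⟨i, ·⟩` form the relation `A i` and those of `w' ⟨i, ·⟩` its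
complement, for each `i` with `σ i = none`; the other `A i` are as prescribed by `σ`. -/
def Represents {M : Type w} {n : ℕ} {ar : Fin n → ℕ} (σ : Fin n → Option Bool) {α : Type}
    (w w' : (Σ i, Fin (ar i)) → α) (A : (i : Fin n) → Set (Fin (ar i) → M)) (X : Set (α → M)) :
    Prop :=
  (∀ i, σ i = none → (∀ a, a ∈ A i ↔ ∃ s ∈ X, blockVal w i s = a) ∧
    ∀ a, a ∉ A i ↔ ∃ s ∈ X, blockVal w' i s = a) ∧
  ∀ i b, σ i = some b → ∀ a, a ∈ A i ↔ b = true

namespace Represents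

variable {M : Type w} {n : ℕ} {ar : Fin n → ℕ} {σ : Fin n → Option Bool} {α β : Type}
  {w w' : (Σ i, Fin (ar i)) → α} {A : (i : Fin n) → Set (Fin (ar i) → M)} {X : Set (α → M)}

/-- The values of the old variables depend only on the projection of the team, so quantifying new
variables preserves the represented relations. -/
theorem lift (h : Represents σ w w' A X) {Y : Set (α ⊕ β → M)}
    (hY : (fun y => y ∘ Sum.inl) '' Y = X) :
    Represents σ (Sum.inl ∘ w) (Sum.inl ∘ w') A Y := by
  subst hY
  simp only [Represents, Set.exists_mem_image] at h
  exact h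

/-- Any tuple lies in `A i` or in its complement, so some assignment takes it as a value and `X` is
nonempty. The values of `w` and `w'` at one assignment then show that `A i` is nontrivial. -/
theorem fits [Nonempty M] (h : Represents σ w w' A X) : Fits σ A := by
  refine ⟨fun i hi => ?_, h.2⟩
  have hX : ∃ s, s ∈ X := by
    let a : Fin (ar i) → M := fun _ => Classical.arbitrary M
    by_cases ha : a ∈ A i
    · obtain ⟨s, hs, -⟩ := ((h.1 i hi).1 a).1 ha
      exact ⟨s, hs⟩
    · obtain ⟨s, hs, -⟩ := ((h.1 i hi).2 a).1 ha
      exact ⟨s, hs⟩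
  obtain ⟨s, hs⟩ := hX
  exact ⟨⟨_, ((h.1 i hi).1 _).2 ⟨s, hs, rfl⟩⟩, _, ((h.1 i hi).2 _).2 ⟨s, hs, rfl⟩⟩

end Represents

theorem image_preimage_comp_inl {M : Type w} [Nonempty M] {α β : Type} (X : Set (α → M)) :
    (fun y : α ⊕ β → M => y ∘ Sum.inl) '' ((fun y => y ∘ Sum.inl) ⁻¹' X) = X :=
  Set.image_preimage_eq X fun s =>
    ⟨Sum.elim s fun _ => Classical.arbitrary M, Sum.elim_comp_inl _ _⟩

theorem snoc_comp_eq {M : Type w} {N : ℕ} {α : Type} (g : Fin N → α) (y : α ⊕ Unit → M) :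
    y ∘ Fin.snoc (α := fun _ => α ⊕ Unit) (Sum.inl ∘ g) (Sum.inr ()) =
      Fin.snoc (α := fun _ => M) ((y ∘ Sum.inl) ∘ g) (y (Sum.inr ())) :=
  Fin.comp_snoc y (Sum.inl ∘ g) (Sum.inr ())

/-- In teams that represent the `A i`, the truth of a prenex formula about the `A i` at all members
is definable in `EXC[k]`. -/
theorem exists_excDefinable_of_isPrenex {L : FirstOrder.Language.{u, v}} {k n N : ℕ}
    {ar : Fin n → ℕ} (hk : ∀ i, ar i ≤ k) (σ : Fin n → Option Bool)
    {δ : (L.sum (relVars ar)).BoundedFormula Empty N} (h : δ.IsPrenex) :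
    ∀ {α : Type} (w w' : (Σ i, Fin (ar i)) → α) (g : Fin N → α),
      ∃ Q : ∀ (M : Type w) [L.Structure M], Set (α → M) → Prop, ExcDefinable L k Q ∧
        ∀ (M : Type w) [Nonempty M] [L.Structure M] (A : (i : Fin n) → Set (Fin (ar i) → M))
          (X : Set (α → M)), Represents σ w w' A X →
            (Q M X ↔ ∀ s ∈ X, letI := relVarsStructure A; δ.Realize default (s ∘ g)) := by
  induction h with
  | of_isQF h =>
    intro α w w' g
    obtain ⟨J, _, r, c, q, hr, hq, hpq⟩ := (LiteralDefinable.of_isQF.{u, v, w} (k := k) σ g h).1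
    -- The exclusion atoms stand outside the flat matrix `q`, hence are evaluated in a team where
    -- `w` and `w'` still take all their values. Excluding `w'` means lying in the relation,
    -- excluding `w` lying outside it.
    refine ⟨_, (hq.excDefinable.and (ExcDefinable.forall_finite fun j =>
      ((ExcDefinable.excl (hk (r j)) (fun l => Sum.inr ⟨j, l⟩)
        (fun l => Sum.inl (w' ⟨r j, l⟩))).imp_prop (c := c j = true)).and
      ((ExcDefinable.excl (hk (r j)) (fun l => Sum.inr ⟨j, l⟩)
        (fun l => Sum.inl (w ⟨r j, l⟩))).imp_prop (c := c j = false)))).exists_block,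
      fun M _ _ A X hX => ?_⟩
    have hA := hX.fits
    refine Iff.trans ?_ (forall₂_congr fun s _ => (hpq M A hA s).symm)
    constructor
    · rintro ⟨Y, hY, h₁, h₂⟩ s hs
      have hYA := hX.lift hY
      obtain ⟨y, hy, rfl⟩ := hY.ge hs
      refine ⟨y ∘ Sum.inr, ?_, fun j => ?_⟩
      · have := h₁ y hy
        rwa [← Sum.elim_comp_inl_inr y] at this
      · rcases hc : c j with _ | _
        · refine iff_of_false (fun ha => ?_) Bool.false_ne_true
          obtain ⟨y', hy', e⟩ := ((hYA.1 _ (hr j)).1 _).1 ha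
          exact (h₂ j).2 hc y hy y' hy' e.symm
        · refine iff_of_true (not_not.1 fun ha => ?_) rfl
          obtain ⟨y', hy', e⟩ := ((hYA.1 _ (hr j)).2 _).1 ha
          exact (h₂ j).1 hc y hy y' hy' e.symm
    · intro h
      -- The team is extended by all correct witnesses at once.
      have hY : (fun y : α ⊕ (Σ j, Fin (ar (r j))) → M => y ∘ Sum.inl) ''
          {y | y ∘ Sum.inl ∈ X ∧ q M y ∧
            ∀ j, (fun l => y (Sum.inr ⟨j, l⟩)) ∈ A (r j) ↔ c j = true} = X := by
        ext s
        constructor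
        · rintro ⟨y, hy, rfl⟩
          exact hy.1
        · intro hs
          obtain ⟨b, hb⟩ := h s hs
          exact ⟨Sum.elim s b, ⟨hs, hb⟩, rfl⟩
      have hYA := hX.lift hY
      refine ⟨_, hY, fun y hy => hy.2.1, fun j => ⟨fun hc y hy y' hy' e => ?_,
        fun hc y hy y' hy' e => ?_⟩⟩
      · exact ((hYA.1 _ (hr j)).2 _).2 ⟨y', hy', e.symm⟩ ((hy.2.2 j).2 hc)
      · exact Bool.false_ne_true (hc.symm.trans
          ((hy.2.2 j).1 (((hYA.1 _ (hr j)).1 _).2 ⟨y', hy', e.symm⟩)))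
  | all _ ih =>
    intro α w w' g
    obtain ⟨Q, hQ, h⟩ := ih (Sum.inl ∘ w) (Sum.inl ∘ w')
      (Fin.snoc (α := fun _ => α ⊕ Unit) (Sum.inl ∘ g) (Sum.inr ()))
    refine ⟨_, hQ.forall_unit, fun M _ _ A X hX => ?_⟩
    refine (h M A _ (hX.lift (image_preimage_comp_inl X))).trans ?_
    simp only [snoc_comp_eq, Language.BoundedFormula.realize_all]
    constructor
    · exact fun h s hs a => h (Sum.elim s fun _ => a) hs
    · exact fun h y hy => h _ hy _
  | @ex N δ _ ih =>
    intro α w w' g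
    obtain ⟨Q, hQ, h⟩ := ih (Sum.inl ∘ w) (Sum.inl ∘ w')
      (Fin.snoc (α := fun _ => α ⊕ Unit) (Sum.inl ∘ g) (Sum.inr ()))
    refine ⟨_, hQ.exists_unit, fun M _ _ A X hX => ?_⟩
    let := relVarsStructure A
    simp only [Language.BoundedFormula.realize_ex]
    constructor
    · rintro ⟨Y, hY, hQY⟩ s hs
      have hYδ := (h M A Y (hX.lift hY)).1 hQY
      obtain ⟨y, hy, rfl⟩ := hY.ge hs
      have := hYδ y hy
      rw [snoc_comp_eq] at this
      exact ⟨_, this⟩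
    · intro hδ
      have hY : (fun y : α ⊕ Unit → M => y ∘ Sum.inl) '' {y | y ∘ Sum.inl ∈ X ∧
          δ.Realize default (Fin.snoc (α := fun _ => M)
            ((y ∘ Sum.inl) ∘ g) (y (Sum.inr ())))} = X := by
        ext s
        constructor
        · rintro ⟨y, hy, rfl⟩
          exact hy.1
        · intro hs
          obtain ⟨a, ha⟩ := hδ s hs
          exact ⟨Sum.elim s fun _ => a, ⟨hs, ha⟩, rfl⟩
      refine ⟨_, hY, (h M A _ (hX.lift hY)).2 fun y hy => ?_⟩
      rw [snoc_comp_eq]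
      exact hy.2

/-! ### Sentences: disjunctions over patterns and the final translation -/

theorem TeamFormula.holds_empty {L : FirstOrder.Language.{u, v}} {M : Type w} [L.Structure M]
    {V : Finset ℕ} (φ : TeamFormula L V) : φ.Holds (∅ : Set (V → M)) := by
  have hS : ∀ {V : Finset ℕ} (x : ℕ) (F : (∅ : Set (V → M)) → Set M), supplement ∅ x F = ∅ :=
    fun x F => Set.eq_empty_of_forall_notMem fun _ ⟨s, _⟩ => s.2
  induction φ with
  | eq => exact fun s hs => hs.elim
  | neq => exact fun s hs => hs.elim
  | rel => exact fun s hs => hs.elim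
  | nrel => exact fun s hs => hs.elim
  | incl => exact fun s hs => hs.elim
  | excl => exact fun s hs => hs.elim
  | and _ _ ih ih' => exact ⟨ih, ih'⟩
  | or _ _ ih ih' => exact ⟨∅, ∅, subset_rfl, subset_rfl, Set.union_self ∅, ih, ih'⟩
  | ex x _ ih => exact ⟨fun _ => Set.univ, fun s => s.2.elim, by rwa [hS]⟩
  | all x _ ih =>
    simp only [TeamFormula.Holds]
    rwa [hS]

/-- The only subteams of a singleton are itself and the empty team, and every formula holds in the
latter. -/
theorem TeamFormula.trueIn_or {L : FirstOrder.Language.{u, v}} {M : Type w} [L.Structure M]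
    (φ ψ : TeamFormula L ∅) : (φ.or ψ).TrueIn M ↔ φ.TrueIn M ∨ ψ.TrueIn M := by
  constructor
  · rintro ⟨Y, Y', hY, hY', h, h₁, h₂⟩
    rcases Set.subset_singleton_iff_eq.1 hY with rfl | rfl
    · rw [Set.empty_union] at h
      subst h
      exact Or.inr h₂
    · exact Or.inl h₁
  · rintro (h | h)
    · exact ⟨_, ∅, subset_rfl, Set.empty_subset _, Set.union_empty _, h, ψ.holds_empty⟩
    · exact ⟨∅, _, Set.empty_subset _, subset_rfl, Set.empty_union _, φ.holds_empty, h⟩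

theorem exists_excSentence_iff_exists {L : FirstOrder.Language.{u, v}} {k : ℕ} {κ : Type}
    [Finite κ] : ∀ φ : κ → EXCSentence L k, ∃ ψ : EXCSentence L k,
      ∀ (M : Type w) [L.Structure M], ψ.1.TrueIn M ↔ ∃ j, (φ j).1.TrueIn M := by
  induction κ using Finite.induction_empty_option with
  | of_equiv e ih =>
    intro φ
    obtain ⟨ψ, hψ⟩ := ih fun j => φ (e j)
    exact ⟨ψ, fun M _ => (hψ M).trans (e.exists_congr_right (q := fun j => (φ j).1.TrueIn M))⟩
  | h_empty =>
    intro φ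
    refine ⟨⟨.excl (m := 0) Fin.elim0 Fin.elim0, Nat.zero_le k⟩, fun M _ => ?_⟩
    refine iff_of_false (fun h => ?_) (fun ⟨j, _⟩ => j.elim)
    exact h _ rfl _ rfl (funext fun i => i.elim0)
  | h_option ih =>
    intro φ
    obtain ⟨ψ, hψ⟩ := ih fun j => φ (some j)
    refine ⟨⟨(φ none).1.or ψ.1, (φ none).2, ψ.2⟩, fun M _ => ?_⟩
    rw [TeamFormula.trueIn_or, hψ, Option.exists]

theorem exists_blockVal_eq {M : Type w} [Nonempty M] {n : ℕ} {ar : Fin n → ℕ} (i : Fin n)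
    (a : Fin (ar i) → M) : ∃ z : (Σ i, Fin (ar i)) → M, (fun l => z ⟨i, l⟩) = a := by
  classical
  exact ⟨fun x => if h : x.1 = i then a (h ▸ x.2) else Classical.arbitrary M,
    funext fun l => dif_pos rfl⟩

theorem exists_excSentence_of_fits {L : FirstOrder.Language.{u, v}} {k : ℕ} (Φ : ESOSentence L k)
    (σ : Fin Φ.n → Option Bool) :
    ∃ φ : EXCSentence L k, ∀ (M : Type w) [Nonempty M] [L.Structure M], φ.1.TrueIn M ↔
      ∃ A : (i : Fin Φ.n) → Set (Fin (Φ.ar i) → M), Fits σ A ∧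
        letI : (relVars Φ.ar).Structure M := relVarsStructure A
        M ⊨ Φ.body := by
  let B := Σ i, Fin (Φ.ar i)
  -- The summand `Empty` stands for the absent free variables; `z` is quantified universally, `w`
  -- and `w'` existentially after it.
  let z : B → (Empty ⊕ B) ⊕ (B ⊕ B) := fun x => Sum.inl (Sum.inr x)
  let w : B → (Empty ⊕ B) ⊕ (B ⊕ B) := fun x => Sum.inr (Sum.inl x)
  let w' : B → (Empty ⊕ B) ⊕ (B ⊕ B) := fun x => Sum.inr (Sum.inr x)
  obtain ⟨Q, hQ, h⟩ := exists_excDefinable_of_isPrenex.{u, v, w} Φ.ar_le σ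
    Φ.body.toPrenex_isPrenex w w' Fin.elim0
  have hv : ∀ u : B → (Empty ⊕ B) ⊕ (B ⊕ B), ∀ i, FlatDefinable L k
      (fun (M : Type w) _ (y : (Empty ⊕ B) ⊕ (B ⊕ B) → M) =>
        ∀ l, y (u ⟨i, l⟩) = y (z ⟨i, l⟩)) := fun u i =>
    FlatDefinable.forall_finite fun l =>
      FlatDefinable.eq (Language.var (u ⟨i, l⟩)) (Language.var (z ⟨i, l⟩))
  have hD := ((ExcDefinable.forall_finite fun i =>
    (((ExcDefinable.excl (Φ.ar_le i) (fun l => w ⟨i, l⟩) (fun l => w' ⟨i, l⟩)).and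
      ((hv w i).or (hv w' i)).excDefinable).imp_prop (c := σ i = none))).and
    hQ).exists_block.forall_block
  obtain ⟨φ, hφ, hφD⟩ := hD ∅ (Equiv.equivOfIsEmpty _ _)
  refine ⟨⟨φ, hφ⟩, fun M _ _ => (hφD M _).trans ?_⟩
  have hX : ((fun y : Empty ⊕ B → M => y ∘ Sum.inl) ⁻¹'
      ((fun s => s ∘ (Equiv.equivOfIsEmpty Empty ↥(∅ : Finset ℕ))) '' {emptyAssignment M})) =
        Set.univ :=
    Set.eq_univ_of_forall fun y => ⟨_, rfl, funext fun x => x.elim⟩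
  have hbody : ∀ (A : (i : Fin Φ.n) → Set (Fin (Φ.ar i) → M))
      (y : (Empty ⊕ B) ⊕ (B ⊕ B) → M),
      (letI := relVarsStructure A; Φ.body.toPrenex.Realize default (y ∘ Fin.elim0)) ↔
        letI := relVarsStructure A; M ⊨ Φ.body := by
    intro A y
    let := relVarsStructure A
    rw [Language.BoundedFormula.realize_toPrenex]
    exact iff_of_eq (congrArg _ (Subsingleton.elim _ _))
  beta_reduce
  rw [hX]
  have hz : ∀ {Y : Set ((Empty ⊕ B) ⊕ (B ⊕ B) → M)},
      (fun y => y ∘ Sum.inl) '' Y = Set.univ → ∀ i a, ∃ y ∈ Y, blockVal z i y = a := by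
    intro Y hY i a
    obtain ⟨b, hb⟩ := exists_blockVal_eq i a
    obtain ⟨y, hy, e⟩ := hY.ge (Set.mem_univ (Sum.elim Empty.elim b))
    refine ⟨y, hy, ?_⟩
    rw [← hb]
    exact funext fun l => congrFun e (Sum.inr ⟨i, l⟩)
  constructor
  · rintro ⟨Y, hY, hc, hQY⟩
    -- Nontrivial relations are read off from the values of `w`; the others follow `σ`.
    let A : (i : Fin Φ.n) → Set (Fin (Φ.ar i) → M) := fun i =>
      {a | (σ i = none ∧ ∃ y ∈ Y, blockVal w i y = a) ∨ σ i = some true}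
    have hA : Represents σ w w' A Y := by
      refine ⟨fun i hi => ?_, fun i b hi a => ?_⟩
      · have hmem : ∀ a, a ∈ A i ↔ ∃ s ∈ Y, blockVal w i s = a := fun a =>
          ⟨fun ha => ha.elim And.right fun ha => by simp [hi] at ha, fun ha => Or.inl ⟨hi, ha⟩⟩
        refine ⟨hmem, fun a => ?_⟩
        rw [hmem]
        constructor
        · intro ha
          -- Some member of the team has `z i = a`, and there `w i` or `w' i` equals `a`; so the
          -- values of the two cover all tuples.
          obtain ⟨y, hy, e⟩ := hz hY i a
          rcases (hc i hi).2 y hy with h | h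
          · exact (ha ⟨y, hy, (funext h).trans e⟩).elim
          · exact ⟨y, hy, (funext h).trans e⟩
        · rintro ⟨y', hy', rfl⟩ ⟨y, hy, e⟩
          exact (hc i hi).1 y hy y' hy' e
      · cases b <;> simp [A, hi]
    -- The body is known only at members of `Y`, so one member is needed to conclude that it is
    -- true.
    obtain ⟨y, hy, -⟩ := hY.ge (Set.mem_univ (fun _ => Classical.arbitrary M))
    exact ⟨A, hA.fits, (hbody A y).1 ((h M A Y hA).1 hQY y hy)⟩
  · rintro ⟨A, hA, hδ⟩
    let Y : Set ((Empty ⊕ B) ⊕ (B ⊕ B) → M) := {y | ∀ i, σ i = none →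
      blockVal w i y ∈ A i ∧ blockVal w' i y ∉ A i ∧
        (blockVal w i y = blockVal z i y ∨ blockVal w' i y = blockVal z i y)}
    have hY : (fun y => y ∘ Sum.inl) '' Y = Set.univ := by
      refine Set.eq_univ_of_forall fun s => ?_
      -- The value of `z i` serves as `w i` or as `w' i` according to membership in `A i`;
      -- nontriviality supplies the other one.
      have hb : ∀ i, ∃ a a' : Fin (Φ.ar i) → M, σ i = none →
          a ∈ A i ∧ a' ∉ A i ∧
            (a = (fun l => s (Sum.inr ⟨i, l⟩)) ∨ a' = (fun l => s (Sum.inr ⟨i, l⟩))) := by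
        intro i
        by_cases hi : σ i = none
        · obtain ⟨⟨a, ha⟩, a', ha'⟩ := hA.1 i hi
          by_cases hs : (fun l => s (Sum.inr ⟨i, l⟩)) ∈ A i
          · exact ⟨_, a', fun _ => ⟨hs, ha', Or.inl rfl⟩⟩
          · exact ⟨a, _, fun _ => ⟨ha, hs, Or.inr rfl⟩⟩
        · exact ⟨fun l => s (Sum.inr ⟨i, l⟩), fun l => s (Sum.inr ⟨i, l⟩), fun h => (hi h).elim⟩
      choose b b' hb using hb
      exact ⟨Sum.elim s (Sum.elim (fun x => b x.1 x.2) (fun x => b' x.1 x.2)), hb, rfl⟩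
    have hYA : Represents σ w w' A Y := by
      refine ⟨fun i hi => ⟨fun a => ⟨fun ha => ?_, ?_⟩, fun a => ⟨fun ha => ?_, ?_⟩⟩, hA.2⟩
      · obtain ⟨y, hy, rfl⟩ := hz hY i a
        rcases (hy i hi).2.2 with e | e
        · exact ⟨y, hy, e⟩
        · exact ((hy i hi).2.1 (e ▸ ha)).elim
      · rintro ⟨y, hy, rfl⟩
        exact (hy i hi).1
      · obtain ⟨y, hy, rfl⟩ := hz hY i a
        rcases (hy i hi).2.2 with e | e
        · exact (ha (e ▸ (hy i hi).1)).elim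
        · exact ⟨y, hy, e⟩
      · rintro ⟨y, hy, rfl⟩
        exact (hy i hi).2.1
    refine ⟨Y, hY, fun i hi => ⟨fun y hy y' hy' e => ?_, fun y hy => ?_⟩,
      (h M A Y hYA).2 fun y _ => (hbody A y).2 hδ⟩
    · exact (hy' i hi).2.1 (Eq.subst (motive := fun a => a ∈ A i) e (hy i hi).1)
    · exact (hy i hi).2.2.imp congrFun congrFun

theorem ESOSentence.exists_excSentence {L : FirstOrder.Language.{u, v}} {k : ℕ}
    (Φ : ESOSentence L k) : ∃ φ : EXCSentence L k,
      ∀ (M : Type w) [Nonempty M] [L.Structure M], Φ.TrueIn M ↔ φ.1.TrueIn M := by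
  choose φ hφ using exists_excSentence_of_fits.{u, v, w} Φ
  obtain ⟨ψ, hψ⟩ := exists_excSentence_iff_exists.{u, v, w} φ
  refine ⟨ψ, fun M _ _ => ?_⟩
  simp only [hψ, hφ]
  constructor
  · rintro ⟨A, hA⟩
    obtain ⟨σ, hσ⟩ := exists_fits A
    exact ⟨σ, A, hσ, hA⟩
  · rintro ⟨σ, A, -, hA⟩
    exact ⟨A, hA⟩

theorem TeamFormula.IsEXC.isINEX {L : FirstOrder.Language.{u, v}} {k : ℕ} {V : Finset ℕ}
    {φ : TeamFormula L V} (h : φ.IsEXC k) : φ.IsINEX k := by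
  induction φ with
  | eq => trivial
  | neq => trivial
  | rel => trivial
  | nrel => trivial
  | incl => exact h.elim
  | excl => exact h
  | and _ _ ih ih' => exact ⟨ih h.1, ih' h.2⟩
  | or _ _ ih ih' => exact ⟨ih h.1, ih' h.2⟩
  | ex _ _ ih => exact ih h
  | all _ _ ih => exact ih h

end TeamLogic

theorem mainTheorem2 (L : FirstOrder.Language.{u, v}) (k : ℕ) :
    ((∀ φ : TeamLogic.EXCSentence L k, ∃ Φ : TeamLogic.ESOSentence L k,
        ∀ (M : Type w) [Nonempty M] [L.Structure M], φ.1.TrueIn M ↔ Φ.TrueIn M) ∧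
      (∀ Φ : TeamLogic.ESOSentence L k, ∃ φ : TeamLogic.EXCSentence L k,
        ∀ (M : Type w) [Nonempty M] [L.Structure M], Φ.TrueIn M ↔ φ.1.TrueIn M)) ∧
    ((∀ ψ : TeamLogic.INEXSentence L k, ∃ φ : TeamLogic.EXCSentence L k,
        ∀ (M : Type w) [Nonempty M] [L.Structure M], ψ.1.TrueIn M ↔ φ.1.TrueIn M) ∧
      (∀ φ : TeamLogic.EXCSentence L k, ∃ ψ : TeamLogic.INEXSentence L k,
        ∀ (M : Type w) [Nonempty M] [L.Structure M], φ.1.TrueIn M ↔ ψ.1.TrueIn M)) := by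
  refine ⟨⟨fun φ => φ.2.isINEX.exists_esoSentence, fun Φ => Φ.exists_excSentence⟩,
    fun ψ => ?_, fun φ => ⟨⟨φ.1, φ.2.isINEX⟩, fun M _ _ => Iff.rfl⟩⟩
  obtain ⟨Φ, hΦ⟩ := ψ.2.exists_esoSentence.{u, v, w}
  obtain ⟨φ, hφ⟩ := Φ.exists_excSentence.{u, v, w}
  exact ⟨φ, fun M _ _ => (hΦ M).trans (hφ M)⟩
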